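/- **Theorem (termination).** Let $n,t$ be integers with $t\ge 0$ and $n>3t$. Consider $n$ processes $p_1,\dots,p_n$, at most $t$ of which are faulty (Byzantine); the others are correct and run the protocol below, process $p_i$ proposing a value $v_i$ from an arbitrary set $V$; $\bot\notin V$ is a default value. *Model.* Each ordered pair of processes is joined by a reliable link (messages are not created, altered, duplicated or lost). Only finitely many steps occur before any given instant; there is no bound on transfer delays. Correct processes are never suspended forever while they can take a step, and there is an unknown finite bound on the time that a correct process that has not returned takes to answer a query it has received. A timer set to $\Delta$ expires eventually, and not before $\Delta$ time units. Messages are signed, and a faulty process may send anything except signed messages of correct processes (alone or inside certificates) that those have not sent before. Every message carries as certificate the signed messages from which its value was computed; messages that are not signed by their sender, whose certificate (checked recursively) does not justify their value according to the protocol, or that duplicate the sender, type and round of an earlier one, are discarded on arrival. *Protocol of $p_i$.* Initially $r_i=0$ and $\Delta_i[c]=1$ for all $c$. Main task: send $\mathrm{INIT}(v_i)$ to all; collect INIT messages from $n-t$ distinct processes; set $est_i$ to a value occurring at least $n-2t$ times among them if there is one, and to $v_i$ otherwise. Then repeat: 1. $c\leftarrow(r_i\bmod n)+1$; $r_i\leftarrow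 r_i+1$; send $\mathrm{QUERY}(r_i,est_i)$ to all and set a timer to $\Delta_i[c]$; wait until $\mathrm{RESPONSE}(r_i,\cdot)$ has been received from the coordinator $p_c$, or the timer has expired and $\mathrm{RESPONSE}(r_i,\cdot)$ has been received from $n-t$ distinct processes. Set $aux_i$ to the value in $p_c$'s response if it has been received, else to $\bot$. If the timer has expired, increment $\Delta_i[c]$ by one. 2. Send $\mathrm{RELAY}(r_i,aux_i)$ to all; collect such messages of round $r_i$ from $n-t$ distinct processes, with set of values $W$; if $W\setminus\{\bot\}=\{v\}$ set $aux_i\leftarrow v$, else $aux_i\leftarrow\bot$. 3. Send $\mathrm{FILT1}(r_i,aux_i)$ to all; collect $n-t$ of them, with set of values $W$; if $W=\{v\}$ set $aux_i\leftarrow v$, else $aux_i\leftarrow\bot$. 4. Send $\mathrm{FILT2}(r_i,aux_i)$ to all; collect $n-t$ of them, with set of values $W$; if $W=\{v\}$ with $v\ne\bot$, send $\mathrm{DEC}(v)$ to all, decide $v$ and return; if $W=\{v,\bot\}$ with $v\neq\bot$, set $est_i\leftarrow v$; otherwise keep $est_i$. Query–response task: upon $\mathrm{QUERY}(r,est)$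 from $p_j$, send $\mathrm{RESPONSE}(r,w)$ to $p_j$, where $w$ is the value of the first query of round $r$ handled by $p_i$ if $p_i$ coordinates round $r$, and $w=\bot$ otherwise. Decision task: upon $\mathrm{DEC}(v)$, send $\mathrm{DEC}(v)$ to all, decide $v$ and return. A process that has returned takes no further step. The response of $p$ to the round-$r$ query of $q$ is *winning* if it is among the first $n-t$ responses of round $r$ that $q$ receives from distinct processes; the response of a correct process to its own queries is always winning. *Assumption.* A process $p$ is a $\diamond 2t$-BW if it is correct and there are disjoint sets $Y,Z$ of processes other than $p$ with $|Y|+|Z|=2t$, a bound $\delta$ and an instant $\tau$ such that: for every correct $q\in Y$, every message sent after $\tau$ from $p$ to $q$ or from $q$ to $p$ is received within $\delta$ time units of its sending; and for every correct $q\in Z$, the response of $p$ to every query issued by $q$ after $\tau$ is winning. *Claim.* In every execution in which there is a $\diamond 2t$-BW, every correct process eventually decides. -/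

import Mathlib

namespace ByzBW

/-- The seven message types of the protocol. -/
inductive Kind where
  | init | query | response | relay | filt1 | filt2 | dec
  deriving DecidableEq

/-- A signed message. `src` is the signer, `round` the round number (`0` for `init` and `dec`,
which carry none), `val` the value (`none` is the default value `⊥`) and `cert` the certificate,
a list of signed messages. -/
inductive Msg (n : ℕ) (V : Type*) where
  | mk (kind : Kind) (src : Fin n) (round : ℕ) (val : Option V) (cert : List (Msg n V)) : Msg n V

namespace Msg

variable {n : ℕ} {V : Type*}

def kind : Msg n V → Kind
  | mk k _ _ _ _ => k

def src : Msg n V → Fin n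
  | mk _ p _ _ _ => p

def round : Msg n V → ℕ
  | mk _ _ r _ _ => r

def val : Msg n V → Option V
  | mk _ _ _ x _ => x

def cert : Msg n V → List (Msg n V)
  | mk _ _ _ _ C => C

/-- `Sub m' m`: the signed message `m'` is `m` or occurs, at any depth, in the certificate
of `m`. -/
inductive Sub : Msg n V → Msg n V → Prop
  | refl (m : Msg n V) : Sub m m
  | cert {a b m : Msg n V} : Sub a b → b ∈ m.cert → Sub a m

end Msg

/-- `p` is the coordinator of round `r ≥ 1` (processes are numbered from `0`). -/
def IsCoord (n r : ℕ) (p : Fin n) : Prop := p.val = (r - 1) % n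

/-- `C` consists of `n - t` messages of type `κ` and round `r` signed by distinct processes. -/
def Quorum {n : ℕ} {V : Type*} (t : ℕ) (κ : Kind) (r : ℕ) (C : List (Msg n V)) : Prop :=
  C.length = n - t ∧ (C.map Msg.src).Nodup ∧ ∀ m ∈ C, m.kind = κ ∧ m.round = r

/-- The set of values carried by the messages of `C` (the set `V_i` of the protocol). -/
def vals {n : ℕ} {V : Type*} (C : List (Msg n V)) : Set (Option V) := {x | ∃ m ∈ C, m.val = x}

/-- The value `v` is carried by at least `n - 2t` messages of `C`. -/
def Frequent {n : ℕ} {V : Type*} (t : ℕ) (C : List (Msg n V)) (v : V) : Prop :=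
  ∃ D : List (Msg n V), D.Sublist C ∧ n - 2 * t ≤ D.length ∧ ∀ m ∈ D, m.val = some v

/-- First estimate: a value received at least `n - 2t` times if there is one, the process's own
proposal otherwise. -/
def InitEst {n : ℕ} {V : Type*} (t : ℕ) (C : List (Msg n V)) (own e : V) : Prop :=
  Frequent t C e ∨ ((¬ ∃ v, Frequent t C v) ∧ e = own)

/-- `if W - {⊥} = {v} then a = v else a = ⊥`. -/
def RelayOut {V : Type*} (W : Set (Option V)) (a : Option V) : Prop :=
  (∃ v : V, W \ {none} = {some v} ∧ a = some v) ∨ ((¬ ∃ v : V, W \ {none} = {some v}) ∧ a = none)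

/-- `if W = {v} then a = v else a = ⊥`. -/
def FiltOut {V : Type*} (W : Set (Option V)) (a : Option V) : Prop :=
  (∃ v : V, W = {some v} ∧ a = some v) ∨ ((¬ ∃ v : V, W = {some v}) ∧ a = none)

/-- The messages that comply with the text of the protocol: the value is the one that the protocol
prescribes from the messages in the certificate, which are themselves valid. In `query_one` the
value `own` is the initial value of `p`, which the signer is free to choose. In `query_keep` the
certificate holds the previous query of `p`, which certifies the value that is kept.
The value in a response of a process that does not coordinate the round is irrelevant. -/
inductive Valid {n : ℕ} {V : Type*} (t : ℕ) : Msg n V → Prop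
  | init (p : Fin n) (v : V) : Valid t (.mk .init p 0 (some v) [])
  | query_one (p : Fin n) (C : List (Msg n V)) (own e : V) :
      Quorum t .init 0 C → (∀ m ∈ C, Valid t m) → InitEst t C own e →
      Valid t (.mk .query p 1 (some e) C)
  | query_adopt (p : Fin n) (r : ℕ) (C : List (Msg n V)) (v : V) :
      Quorum t .filt2 r C → (∀ m ∈ C, Valid t m) → vals C = {some v, none} →
      Valid t (.mk .query p (r + 1) (some v) C)
  | query_keep (p : Fin n) (r : ℕ) (C D : List (Msg n V)) (e : V) :
      Quorum t .filt2 r C → (∀ m ∈ C, Valid t m) →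
      (¬ ∃ v, vals C = {some v}) → (¬ ∃ v, vals C = {some v, none}) →
      Valid t (.mk .query p r (some e) D) →
      Valid t (.mk .query p (r + 1) (some e) (.mk .query p r (some e) D :: C))
  | response_coord (p : Fin n) (r : ℕ) (q : Msg n V) :
      IsCoord n r p → q.kind = .query → q.round = r → Valid t q →
      Valid t (.mk .response p r q.val [q])
  | response_other (p : Fin n) (r : ℕ) (x : Option V) :
      ¬ IsCoord n r p → Valid t (.mk .response p r x [])
  | relay_val (p : Fin n) (r : ℕ) (m : Msg n V) :
      m.kind = .response → m.round = r → IsCoord n r m.src → Valid t m →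
      Valid t (.mk .relay p r m.val [m])
  | relay_bot (p : Fin n) (r : ℕ) (C : List (Msg n V)) :
      Quorum t .response r C → (∀ m ∈ C, Valid t m) → (∀ m ∈ C, ¬ IsCoord n r m.src) →
      Valid t (.mk .relay p r none C)
  | filt1 (p : Fin n) (r : ℕ) (C : List (Msg n V)) (a : Option V) :
      Quorum t .relay r C → (∀ m ∈ C, Valid t m) → RelayOut (vals C) a →
      Valid t (.mk .filt1 p r a C)
  | filt2 (p : Fin n) (r : ℕ) (C : List (Msg n V)) (a : Option V) :
      Quorum t .filt1 r C → (∀ m ∈ C, Valid t m) → FiltOut (vals C) a →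
      Valid t (.mk .filt2 p r a C)
  | dec (p : Fin n) (r : ℕ) (C : List (Msg n V)) (v : V) :
      Quorum t .filt2 r C → (∀ m ∈ C, Valid t m) → vals C = {some v} →
      Valid t (.mk .dec p 0 (some v) C)

/-- Control locations of the basic task. -/
inductive Loc where
  | start | waitInit | newRound | waitResponse | waitRelay | waitFilt1 | waitFilt2 | halted
  deriving DecidableEq

/-- Local state of a correct process. `delta c` is the current time-out value for `c`; `deadline`
is the earliest instant at which the current timer may expire; `rcvd` holds the valid messages
received so far; `answered` holds the queries already answered by the query-response task;
`cest r` is the query from which the coordination value of round `r` was taken, if any. -/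
structure LState (n : ℕ) (V : Type*) where
  loc : Loc
  round : ℕ
  est : V
  estCert : List (Msg n V)
  delta : Fin n → ℕ
  deadline : ℝ
  expired : Bool
  rcvd : Set (Msg n V)
  answered : Set (Msg n V)
  cest : ℕ → Option (Msg n V)
  decision : Option V

/-- Initial local state of a process that proposes `v`. -/
def LState.initial {n : ℕ} {V : Type*} (v : V) : LState n V where
  loc := .start
  round := 0
  est := v
  estCert := []
  delta := fun _ => 1
  deadline := 0
  expired := false
  rcvd := ∅
  answered := ∅
  cest := fun _ => none
  decision := none

open Classical in
/-- The message filter: a message that arrives on the link from `p` is kept if it is signed by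
`p`, valid, and not a duplicate (same sender, type and round) of one that was kept before. -/
noncomputable def LState.accept {n : ℕ} {V : Type*} (t : ℕ) (p : Fin n) (m : Msg n V)
    (s : LState n V) : LState n V :=
  if m.src = p ∧ Valid t m ∧
      ¬ ∃ m' ∈ s.rcvd, m'.src = m.src ∧ m'.kind = m.kind ∧ m'.round = m.round
  then { s with rcvd := insert m s.rcvd } else s

open Classical in
/-- The time-out values after the coordinator's timer of the current round was handled:
the entry of the coordinator is incremented if its timer has expired. -/
noncomputable def LState.newDelta {n : ℕ} {V : Type*} (s : LState n V) : Fin n → ℕ :=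
  fun c => if s.expired = true ∧ IsCoord n s.round c then s.delta c + 1 else s.delta c

/-- One step of the basic task of process `p` (with proposal `own`) at instant `now`, from `s` to
`s'`; `o` is the message, if any, that is sent to all processes. -/
inductive MainStep {n : ℕ} {V : Type*} (t : ℕ) (p : Fin n) (own : V) (now : ℝ) (s : LState n V) :
    Option (Msg n V) → LState n V → Prop
  | start : s.loc = .start →
      MainStep t p own now s (some (.mk .init p 0 (some own) [])) { s with loc := .waitInit }
  | init (C : List (Msg n V)) (e : V) : s.loc = .waitInit →
      (∀ m ∈ C, m ∈ s.rcvd) → Quorum t .init 0 C → InitEst t C own e →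
      MainStep t p own now s none { s with loc := .newRound, est := e, estCert := C }
  | query (c : Fin n) : s.loc = .newRound → IsCoord n (s.round + 1) c →
      MainStep t p own now s (some (.mk .query p (s.round + 1) (some s.est) s.estCert))
        { s with
          loc := .waitResponse, round := s.round + 1,
          deadline := now + s.delta c, expired := false }
  | response_val (m : Msg n V) : s.loc = .waitResponse →
      m ∈ s.rcvd → m.kind = .response → m.round = s.round → IsCoord n s.round m.src →
      MainStep t p own now s (some (.mk .relay p s.round m.val [m]))
        { s with loc := .waitRelay, delta := s.newDelta }
  | response_bot (C : List (Msg n V)) : s.loc = .waitResponse →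
      (¬ ∃ m ∈ s.rcvd, m.kind = .response ∧ m.round = s.round ∧ IsCoord n s.round m.src) →
      s.expired = true → (∀ m ∈ C, m ∈ s.rcvd) → Quorum t .response s.round C →
      MainStep t p own now s (some (.mk .relay p s.round none C))
        { s with loc := .waitRelay, delta := s.newDelta }
  | relay (C : List (Msg n V)) (a : Option V) : s.loc = .waitRelay →
      (∀ m ∈ C, m ∈ s.rcvd) → Quorum t .relay s.round C → RelayOut (vals C) a →
      MainStep t p own now s (some (.mk .filt1 p s.round a C)) { s with loc := .waitFilt1 }
  | filt1 (C : List (Msg n V)) (a : Option V) : s.loc = .waitFilt1 →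
      (∀ m ∈ C, m ∈ s.rcvd) → Quorum t .filt1 s.round C → FiltOut (vals C) a →
      MainStep t p own now s (some (.mk .filt2 p s.round a C)) { s with loc := .waitFilt2 }
  | filt2_decide (C : List (Msg n V)) (v : V) : s.loc = .waitFilt2 →
      (∀ m ∈ C, m ∈ s.rcvd) → Quorum t .filt2 s.round C → vals C = {some v} →
      MainStep t p own now s (some (.mk .dec p 0 (some v) C))
        { s with loc := .halted, decision := some v }
  | filt2_adopt (C : List (Msg n V)) (v : V) : s.loc = .waitFilt2 →
      (∀ m ∈ C, m ∈ s.rcvd) → Quorum t .filt2 s.round C → vals C = {some v, none} →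
      MainStep t p own now s none { s with loc := .newRound, est := v, estCert := C }
  | filt2_keep (C : List (Msg n V)) : s.loc = .waitFilt2 →
      (∀ m ∈ C, m ∈ s.rcvd) → Quorum t .filt2 s.round C →
      (¬ ∃ v, vals C = {some v}) → (¬ ∃ v, vals C = {some v, none}) →
      MainStep t p own now s none
        { s with
          loc := .newRound,
          estCert := .mk .query p s.round (some s.est) s.estCert :: C }

/-- One step of the query-response task of process `p`: it answers the query `q` with the
message `o`, sent to the signer of `q`. -/
inductive RespondStep {n : ℕ} {V : Type*} (p : Fin n) (q : Msg n V) (s : LState n V) :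
    Msg n V → LState n V → Prop
  | first : s.loc ≠ .halted → q ∈ s.rcvd → q.kind = .query → q ∉ s.answered →
      IsCoord n q.round p → s.cest q.round = none →
      RespondStep p q s (.mk .response p q.round q.val [q])
        { s with
          answered := insert q s.answered,
          cest := Function.update s.cest q.round (some q) }
  | again (q₀ : Msg n V) : s.loc ≠ .halted → q ∈ s.rcvd → q.kind = .query → q ∉ s.answered →
      IsCoord n q.round p → s.cest q.round = some q₀ →
      RespondStep p q s (.mk .response p q.round q₀.val [q₀])
        { s with answered := insert q s.answered }
  | other : s.loc ≠ .halted → q ∈ s.rcvd → q.kind = .query → q ∉ s.answered →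
      ¬ IsCoord n q.round p →
      RespondStep p q s (.mk .response p q.round none [])
        { s with answered := insert q s.answered }

/-- What can happen at one point of an execution. -/
inductive Action (n : ℕ) (V : Type*) where
  /-- nothing -/
  | idle
  /-- the message sent at point `i` to process `q` is received by `q` -/
  | receive (i : ℕ) (q : Fin n)
  /-- a step of the basic task of `p` -/
  | main (p : Fin n)
  /-- the timer of `p` expires -/
  | expire (p : Fin n)
  /-- the query-response task of `p` answers the query `q` -/
  | respond (p : Fin n) (q : Msg n V)
  /-- the decision task of `p` handles the decision message `m` -/
  | decide (p : Fin n) (m : Msg n V)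
  /-- a step of the faulty process `p` -/
  | byz (p : Fin n)

/-- The process that executes an action (and sends the messages it produces), if any. -/
def Action.actor {n : ℕ} {V : Type*} : Action n V → Option (Fin n)
  | .idle => none
  | .receive _ _ => none
  | .main p => some p
  | .expire p => some p
  | .respond p _ => some p
  | .decide p _ => some p
  | .byz p => some p

/-- Raw data of an execution: at point `k`, which lies at instant `time k`, the action `act k` takes
the local states `state k` to `state (k + 1)`, and `out k q` is the message, if any, that is sent
to `q`. -/
structure Trace (n : ℕ) (V : Type*) where
  time : ℕ → ℝ
  act : ℕ → Action n V
  out : ℕ → Fin n → Option (Msg n V)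
  state : ℕ → Fin n → LState n V

namespace Trace

variable {n : ℕ} {V : Type*}

/-- At point `i` process `p` sends `m` to `q`. -/
def Sends (ρ : Trace n V) (i : ℕ) (p q : Fin n) (m : Msg n V) : Prop :=
  (ρ.act i).actor = some p ∧ ρ.out i q = some m

/-- The transition at point `k` is legal, for faulty processes `F` and proposals `input`.
Correct processes follow the protocol; a faulty process sends anything to anyone, except that a
signed message of a correct process can only appear, alone or within certificates, if that process
has sent it before. A message is received at most once. -/
def StepOK (ρ : Trace n V) (t : ℕ) (F : Finset (Fin n)) (input : Fin n → V) (k : ℕ) : Prop :=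
  match ρ.act k with
  | .idle => ρ.out k = (fun _ => none) ∧ ρ.state (k + 1) = ρ.state k
  | .receive i q =>
      i < k ∧ (∀ j < k, ρ.act j ≠ .receive i q) ∧ ρ.out k = (fun _ => none) ∧
      ∃ p m, ρ.Sends i p q m ∧
        ρ.state (k + 1) =
          if q ∈ F then ρ.state k
          else Function.update (ρ.state k) q ((ρ.state k q).accept t p m)
  | .main p =>
      p ∉ F ∧ ∃ o s', MainStep t p (input p) (ρ.time k) (ρ.state k p) o s' ∧
        ρ.out k = (fun _ => o) ∧ ρ.state (k + 1) = Function.update (ρ.state k) p s'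
  | .expire p =>
      p ∉ F ∧ (ρ.state k p).loc = .waitResponse ∧ (ρ.state k p).expired = false ∧
      (ρ.state k p).deadline ≤ ρ.time k ∧ ρ.out k = (fun _ => none) ∧
      ρ.state (k + 1) = Function.update (ρ.state k) p { ρ.state k p with expired := true }
  | .respond p q =>
      p ∉ F ∧ ∃ o s', RespondStep p q (ρ.state k p) o s' ∧
        ρ.out k = (fun j => if j = q.src then some o else none) ∧
        ρ.state (k + 1) = Function.update (ρ.state k) p s'
  | .decide p m =>
      p ∉ F ∧ (ρ.state k p).loc ≠ .halted ∧ m ∈ (ρ.state k p).rcvd ∧ m.kind = .dec ∧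
      ρ.out k = (fun _ => some (.mk .dec p 0 m.val m.cert)) ∧
      ρ.state (k + 1) =
        Function.update (ρ.state k) p { ρ.state k p with loc := .halted, decision := m.val }
  | .byz p =>
      p ∈ F ∧ ρ.state (k + 1) = ρ.state k ∧
      ∀ q m, ρ.out k q = some m → ∀ m', Msg.Sub m' m → m'.src ∉ F →
        ∃ i < k, ∃ q', ρ.Sends i m'.src q' m'

/-- The basic task of `p` can take a step at point `k`. -/
def MainEnabled (ρ : Trace n V) (t : ℕ) (input : Fin n → V) (k : ℕ) (p : Fin n) : Prop :=
  ∃ o s', MainStep t p (input p) (ρ.time k) (ρ.state k p) o s'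

/-- At point `k` process `q` issues its query of round `r`. -/
def IssuesQuery (ρ : Trace n V) (k : ℕ) (q : Fin n) (r : ℕ) : Prop :=
  ρ.act k = .main q ∧ ∃ m : Msg n V, m.kind = .query ∧ m.round = r ∧ ∀ p, ρ.out k p = some m

/-- The processes whose response for round `r` has been received by `q` before point `k`. -/
def responders (ρ : Trace n V) (k : ℕ) (q : Fin n) (r : ℕ) : Set (Fin n) :=
  {p | ∃ m ∈ (ρ.state k q).rcvd, m.kind = .response ∧ m.round = r ∧ m.src = p}

/-- The response of `p` to the query of round `r` of `q` is winning: it is among the first `n - t`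
responses that `q` receives. Responses arrive one at a time, so this says that `p` is among the
responders as soon as there are `n - t` of them. -/
def Winning (ρ : Trace n V) (t : ℕ) (p q : Fin n) (r : ℕ) : Prop :=
  ∀ k, n - t ≤ (ρ.responders k q r).ncard → p ∈ ρ.responders k q r

/-- The response from `p` to each query that `q` issues at instant `τ` is winning. -/
def WinningLinkAt (ρ : Trace n V) (t : ℕ) (p q : Fin n) (τ : ℝ) : Prop :=
  ∀ k r, ρ.time k = τ → ρ.IssuesQuery k q r → ρ.Winning t p q r

/-- The link from `p` to `q` is timely at instant `τ`, with bound `δ`. -/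
def TimelyLinkAt (ρ : Trace n V) (F : Finset (Fin n)) (δ : ℝ) (p q : Fin n) (τ : ℝ) : Prop :=
  (∀ i j m, ρ.time i = τ → ρ.Sends i p q m → ρ.act j = .receive i q → ρ.time j ≤ τ + δ) ∨ q ∈ F

/-- `p` is a `◇x`-BW: it is correct and has `x` privileged neighbours, split into `Y` and `Z`, such
that from some instant on the links in both directions between `p` and each correct process of `Y`
are timely, and the link from `p` to each correct process of `Z` is winning. -/
def IsEventuallyBW (ρ : Trace n V) (t : ℕ) (F : Finset (Fin n)) (x : ℕ) (p : Fin n) : Prop :=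
  p ∉ F ∧ ∃ Y Z : Finset (Fin n), Disjoint Y Z ∧ p ∉ Y ∧ p ∉ Z ∧ Y.card + Z.card = x ∧
    ∃ δ τ : ℝ, ∀ τ' ≥ τ,
      (∀ q ∈ Y, q ∉ F → ρ.TimelyLinkAt F δ p q τ' ∧ ρ.TimelyLinkAt F δ q p τ') ∧
      (∀ q ∈ Z, q ∉ F → ρ.WinningLinkAt t p q τ')

/-- The executions of the protocol among `n` processes, those in `F` being faulty and process `p`
proposing `input p`. -/
structure IsRun (ρ : Trace n V) (t : ℕ) (F : Finset (Fin n)) (input : Fin n → V) : Prop where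
  time_mono : Monotone ρ.time
  time_unbounded : Filter.Tendsto ρ.time Filter.atTop Filter.atTop
  initial : ∀ p, ρ.state 0 p = LState.initial (input p)
  step : ∀ k, ρ.StepOK t F input k
  /-- links lose no message -/
  reliable : ∀ i p q m, q ∉ F → ρ.Sends i p q m → ∃ k, ρ.act k = .receive i q
  /-- the basic task of a correct process is not suspended forever while it can take a step -/
  main_fair : ∀ p, p ∉ F → ∀ k, ρ.MainEnabled t input k p →
    ∃ j ≥ k, ρ.act j = .main p ∨ ¬ ρ.MainEnabled t input j p
  /-- a running timer expires sooner or later -/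
  timer_fair : ∀ p, p ∉ F → ∀ k, (ρ.state k p).loc = .waitResponse →
    ∃ j ≥ k, (ρ.state j p).expired = true ∨ (ρ.state j p).loc ≠ .waitResponse
  /-- processes are partially synchronous: there is an unknown bound on the time that a correct
  process takes to answer a query, counted from its reception (the transition at point `k` leads to
`state (k + 1)`), unless the process returns within that time -/
  respond_bound : ∃ φ : ℝ, ∀ p, p ∉ F → ∀ k, ∀ m ∈ (ρ.state (k + 1) p).rcvd, m.kind = .query →
    ∃ j, ρ.time j ≤ ρ.time k + φ ∧ (ρ.act j = .respond p m ∨ (ρ.state (j + 1) p).loc = .halted)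
  /-- a correct process that has received a decision message handles it unless it returns first -/
  decide_fair : ∀ p, p ∉ F → ∀ k, ∀ m ∈ (ρ.state k p).rcvd, m.kind = .dec →
    ∃ j, ρ.act j = .decide p m ∨ (ρ.state j p).loc = .halted
  /-- the response of a correct process to its own queries is always winning -/
  own_winning : ∀ p, p ∉ F → ∀ k r, ρ.IssuesQuery k p r → ρ.Winning t p p r

end Trace

end ByzBW

/-!
Suppose that no correct process ever halts. Unforgeability (`Trace.IsRun.authentic`) says that any
message of a correct process found in a message held by a correct process, at whatever depth of
certificates, was really sent by its signer.

*Progress.* All messages of correct processes are valid, hence they are accepted on arrival or have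
been preceded by one of the same sender, type and round. As every wait of the protocol is for a
quorum of `n - t` messages (for the responses, after a timer that expires), which the correct
processes provide, all of them go through all rounds (`Trace.IsRun.reaches_newRound`).

*Hearing from the `◇2t`-BW `x`.* At least `t + 1` of the `2t + 1` processes in `Y ∪ Z ∪ {x}` are
correct. In the late rounds coordinated by `x` each of them holds the response of `x` when it stops
waiting. For `x` itself and for `Z`, this holds because the response is winning and `n - t` responses
are awaited (`Trace.IsRun.not_givesUp_of_winning`). For a process of `Y`, each failure increments its
time-out value for `x`; after finitely many failures this value exceeds the bound on a round trip,
which excludes further failures (`Trace.IsRun.exists_not_givesUp_of_timely`).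

*Agreement in such a round* (`Trace.IsRun.exists_filt2_value`). The correct coordinator `x` has one
value `v ≠ ⊥` for the round, so a valid relay carries `v` or `⊥`, and those of the above `t + 1`
correct processes carry `v`. Every quorum contains one of them, hence all valid `filt1` messages, and
then all valid `filt2` messages, carry `v`, even those of faulty processes, since the certificates
must justify them. A correct process that completes the round would thus decide and halt, which is a
contradiction. So some correct process halts; its decision message makes all others decide
(`Trace.IsRun.decides_of_halted`).
-/

namespace ByzBW

variable {n : ℕ} {V : Type*}

/-! ### Messages and quorums -/

theorem Msg.Sub.eq_or_mem_cert {a m : Msg n V} (h : Msg.Sub a m) :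
    a = m ∨ ∃ b ∈ m.cert, Msg.Sub a b := by
  cases h with
  | refl => exact .inl rfl
  | cert h hb => exact .inr ⟨_, hb, h⟩

theorem IsCoord.eq {r : ℕ} {p q : Fin n} (hp : IsCoord n r p) (hq : IsCoord n r q) : p = q :=
  Fin.ext (hp.trans hq.symm)

theorem exists_isCoord (hn : 0 < n) (r : ℕ) : ∃ c, IsCoord n r c :=
  ⟨⟨(r - 1) % n, Nat.mod_lt _ hn⟩, rfl⟩

/-- A quorum misses only `t` processes, so it contains a message from any larger set. -/
theorem Quorum.exists_src_mem {t : ℕ} {κ : Kind} {r : ℕ} {C : List (Msg n V)}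
    (hC : Quorum t κ r C) {A : Finset (Fin n)} (hA : t < A.card) : ∃ m ∈ C, m.src ∈ A := by
  by_contra! h
  have hdis : Disjoint (C.map Msg.src).toFinset A := by
    rw [Finset.disjoint_left]
    intro a ha haA
    obtain ⟨m, hm, rfl⟩ := List.mem_map.1 (List.mem_toFinset.1 ha)
    exact h m hm haA
  have hcard := Finset.card_union_of_disjoint hdis
  have hle := Finset.card_le_univ ((C.map Msg.src).toFinset ∪ A)
  rw [List.toFinset_card_of_nodup hC.2.1, List.length_map, hC.1] at hcard
  rw [Fintype.card_fin] at hle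
  have hA' := Finset.card_le_univ A
  rw [Fintype.card_fin] at hA'
  omega

/-- The correct processes alone make up a quorum. -/
theorem exists_quorum {t : ℕ} {F : Finset (Fin n)} (hF : F.card ≤ t) {κ : Kind} {r : ℕ}
    {S : Set (Msg n V)} (h : ∀ q ∉ F, ∃ m ∈ S, m.src = q ∧ m.kind = κ ∧ m.round = r) :
    ∃ C : List (Msg n V), (∀ m ∈ C, m ∈ S) ∧ Quorum t κ r C := by
  have h' : ∀ q : Fin n, ∃ m : Msg n V, q ∉ F → m ∈ S ∧ m.src = q ∧ m.kind = κ ∧ m.round = r := by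
    intro q
    by_cases hq : q ∈ F
    · exact ⟨.mk .init q 0 none [], fun hq' => (hq' hq).elim⟩
    · obtain ⟨m, hm⟩ := h q hq
      exact ⟨m, fun _ => hm⟩
  choose f hf using h'
  have hcard : n - t ≤ (Fᶜ).card := by
    rw [Finset.card_compl, Fintype.card_fin]; omega
  obtain ⟨T, hTF, hT⟩ := Finset.exists_subset_card_eq hcard
  have hT' : ∀ q ∈ T.toList, q ∉ F := fun q hq =>
    Finset.mem_compl.1 (hTF (Finset.mem_toList.1 hq))
  refine ⟨T.toList.map f, ?_, ?_, ?_, ?_⟩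
  · intro m hm
    obtain ⟨q, hq, rfl⟩ := List.mem_map.1 hm
    exact (hf q (hT' q hq)).1
  · rw [List.length_map, Finset.length_toList, hT]
  · rw [List.map_map, List.map_congr_left (f := Msg.src ∘ f) (g := id)
      fun q hq => (hf q (hT' q hq)).2.1, List.map_id]
    exact Finset.nodup_toList T
  · intro m hm
    obtain ⟨q, hq, rfl⟩ := List.mem_map.1 hm
    exact (hf q (hT' q hq)).2.2

theorem exists_initEst (t : ℕ) (C : List (Msg n V)) (own : V) : ∃ e, InitEst t C own e := by
  by_cases h : ∃ v, Frequent t C v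
  · exact h.imp fun _ => .inl
  · exact ⟨own, .inr ⟨h, rfl⟩⟩

theorem exists_relayOut (W : Set (Option V)) : ∃ a, RelayOut W a := by
  by_cases h : ∃ v : V, W \ {none} = {some v}
  · obtain ⟨v, hv⟩ := h
    exact ⟨_, .inl ⟨v, hv, rfl⟩⟩
  · exact ⟨none, .inr ⟨h, rfl⟩⟩

theorem exists_filtOut (W : Set (Option V)) : ∃ a, FiltOut W a := by
  by_cases h : ∃ v : V, W = {some v}
  · obtain ⟨v, hv⟩ := h
    exact ⟨_, .inl ⟨v, hv, rfl⟩⟩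
  · exact ⟨none, .inr ⟨h, rfl⟩⟩

theorem RelayOut.eq_some {W : Set (Option V)} {a : Option V} {v : V} (h : RelayOut W a)
    (hW : W \ {none} = {some v}) : a = some v := by
  rcases h with ⟨w, hw, rfl⟩ | ⟨hno, -⟩
  · exact Set.singleton_injective (hw.symm.trans hW)
  · exact (hno ⟨v, hW⟩).elim

theorem FiltOut.eq_some {W : Set (Option V)} {a : Option V} {v : V} (h : FiltOut W a)
    (hW : W = {some v}) : a = some v := by
  rcases h with ⟨w, hw, rfl⟩ | ⟨hno, -⟩
  · exact Set.singleton_injective (hw.symm.trans hW)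
  · exact (hno ⟨v, hW⟩).elim

theorem Valid.exists_val_of_query {t : ℕ} {m : Msg n V} (h : Valid t m) (hk : m.kind = .query) :
    ∃ v, m.val = some v := by
  cases h <;> first | exact ⟨_, rfl⟩ | simp [Msg.kind] at hk

theorem Valid.exists_val_of_dec {t : ℕ} {m : Msg n V} (h : Valid t m) (hk : m.kind = .dec) :
    ∃ v, m.val = some v := by
  cases h <;> first | exact ⟨_, rfl⟩ | simp [Msg.kind] at hk

theorem Valid.forward_dec {t : ℕ} {m : Msg n V} (h : Valid t m) (hk : m.kind = .dec)
    (p : Fin n) : Valid t (.mk .dec p 0 m.val m.cert) := by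
  cases h with
  | dec q r C v hC hv hW => exact .dec p r C v hC hv hW
  | _ => simp [Msg.kind] at hk

theorem Valid.relay_cases {t : ℕ} {m : Msg n V} (h : Valid t m) (hk : m.kind = .relay) :
    m.val = none ∨ ∃ b ∈ m.cert, b.kind = .response ∧ b.round = m.round ∧
      IsCoord n m.round b.src ∧ m.val = b.val := by
  cases h with
  | relay_val p r b h1 h2 h3 h4 => exact .inr ⟨b, by simp [Msg.cert], h1, h2, h3, rfl⟩
  | relay_bot => exact .inl rfl
  | _ => simp [Msg.kind] at hk

theorem Valid.filt1_cert {t : ℕ} {m : Msg n V} (h : Valid t m) (hk : m.kind = .filt1) :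
    Quorum t .relay m.round m.cert ∧ (∀ b ∈ m.cert, Valid t b) ∧
      RelayOut (vals m.cert) m.val := by
  cases h with
  | filt1 p r C a h1 h2 h3 => exact ⟨h1, h2, h3⟩
  | _ => simp [Msg.kind] at hk

theorem Valid.filt2_cert {t : ℕ} {m : Msg n V} (h : Valid t m) (hk : m.kind = .filt2) :
    Quorum t .filt1 m.round m.cert ∧ (∀ b ∈ m.cert, Valid t b) ∧
      FiltOut (vals m.cert) m.val := by
  cases h with
  | filt2 p r C a h1 h2 h3 => exact ⟨h1, h2, h3⟩
  | _ => simp [Msg.kind] at hk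

theorem Quorum.ne_nil {t : ℕ} (ht : t < n) {κ : Kind} {r : ℕ} {C : List (Msg n V)}
    (hC : Quorum t κ r C) : C ≠ [] := by
  rintro rfl
  have := hC.1
  simp at this
  omega

theorem vals_eq_singleton {C : List (Msg n V)} {x : Option V} (hne : C ≠ [])
    (h : ∀ m ∈ C, m.val = x) : vals C = {x} := by
  obtain ⟨m, hm⟩ := List.exists_mem_of_ne_nil C hne
  ext y
  constructor
  · rintro ⟨b, hb, rfl⟩
    exact h b hb
  · rintro rfl
    exact ⟨m, hm, h m hm⟩

/-! ### Local states of correct processes -/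

/-- The type of the message that a process sent to all on entering the given control location
(at `waitResponse`, this is the query). -/
def Loc.sent : Loc → Option Kind
  | .waitInit => some .init
  | .waitResponse => some .query
  | .waitRelay => some .relay
  | .waitFilt1 => some .filt1
  | .waitFilt2 => some .filt2
  | _ => none

/-- `p` is inside a round: it has issued the query of its current round and has not finished that
round yet. -/
def LState.InRound (s : LState n V) : Prop :=
  s.loc = .waitResponse ∨ s.loc = .waitRelay ∨ s.loc = .waitFilt1 ∨ s.loc = .waitFilt2

/-- The properties of the local state of a correct process `p` that make every message it sends
valid and its decision a proper value. -/
structure LState.Coherent (t : ℕ) (p : Fin n) (s : LState n V) : Prop where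
  valid : ∀ m ∈ s.rcvd, Valid t m
  cest : ∀ r q, s.cest r = some q → q ∈ s.rcvd ∧ q.kind = .query ∧ q.round = r
  halted : s.loc = .halted → ∃ v, s.decision = some v
  round_eq_zero : s.loc = .start ∨ s.loc = .waitInit → s.round = 0
  next_query : s.loc = .newRound → Valid t (.mk .query p (s.round + 1) (some s.est) s.estCert)
  query : s.InRound → Valid t (.mk .query p s.round (some s.est) s.estCert)

theorem LState.coherent_initial (t : ℕ) (p : Fin n) (v : V) :
    (LState.initial v : LState n V).Coherent t p := by
  constructor <;> simp [LState.initial, LState.InRound]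

theorem LState.accept_cases (t : ℕ) (p : Fin n) (m : Msg n V) (s : LState n V) :
    s.accept t p m = s ∨
      m.src = p ∧ Valid t m ∧ s.accept t p m = { s with rcvd := insert m s.rcvd } := by
  unfold LState.accept
  split_ifs with h
  · exact .inr ⟨h.1, h.2.1, rfl⟩
  · exact .inl rfl

/-- A properly signed valid message is either kept or was preceded by one with the same sender,
type and round. -/
theorem LState.exists_mem_accept {t : ℕ} {p : Fin n} {m : Msg n V} (s : LState n V)
    (hp : m.src = p) (hv : Valid t m) :
    ∃ m' ∈ (s.accept t p m).rcvd, m'.src = m.src ∧ m'.kind = m.kind ∧ m'.round = m.round := by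
  unfold LState.accept
  split_ifs with h
  · exact ⟨m, Set.mem_insert _ _, rfl, rfl, rfl⟩
  · by_contra h'
    exact h ⟨hp, hv, h'⟩

theorem LState.Coherent.accept {t : ℕ} {p : Fin n} {s : LState n V} (hs : s.Coherent t p)
    (q : Fin n) (m : Msg n V) : (s.accept t q m).Coherent t p := by
  rcases s.accept_cases t q m with h | ⟨-, hm, h⟩
  · rwa [h]
  · rw [h]
    refine ⟨?_, ?_, hs.halted, hs.round_eq_zero, hs.next_query, hs.query⟩
    · rintro b (rfl | hb)
      exacts [hm, hs.valid b hb]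
    · intro r b hb
      exact ⟨Set.mem_insert_of_mem _ (hs.cest r b hb).1, (hs.cest r b hb).2⟩

theorem LState.Coherent.mainStep {t : ℕ} {p : Fin n} {own : V} {now : ℝ} {s s' : LState n V}
    {o : Option (Msg n V)} (hs : s.Coherent t p) (h : MainStep t p own now s o s') :
    s'.Coherent t p := by
  have hval {C : List (Msg n V)} (hC : ∀ m ∈ C, m ∈ s.rcvd) : ∀ m ∈ C, Valid t m :=
    fun m hm => hs.valid m (hC m hm)
  cases h with
  | start hl =>
    exact ⟨hs.valid, hs.cest, by simp, fun _ => hs.round_eq_zero (.inl hl), by simp,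
      by simp [InRound]⟩
  | init C e hl hC hQ hE =>
    refine ⟨hs.valid, hs.cest, by simp, by simp, fun _ => ?_, by simp [InRound]⟩
    simp only [hs.round_eq_zero (.inr hl)]
    exact .query_one p C own e hQ (hval hC) hE
  | query c hl hc =>
    exact ⟨hs.valid, hs.cest, by simp, by simp, by simp, fun _ => hs.next_query hl⟩
  | response_val m hl =>
    exact ⟨hs.valid, hs.cest, by simp, by simp, by simp, fun _ => hs.query (.inl hl)⟩
  | response_bot C hl =>
    exact ⟨hs.valid, hs.cest, by simp, by simp, by simp, fun _ => hs.query (.inl hl)⟩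
  | relay C a hl =>
    exact ⟨hs.valid, hs.cest, by simp, by simp, by simp, fun _ => hs.query (.inr (.inl hl))⟩
  | filt1 C a hl =>
    exact ⟨hs.valid, hs.cest, by simp, by simp, by simp,
      fun _ => hs.query (.inr (.inr (.inl hl)))⟩
  | filt2_decide C v hl =>
    exact ⟨hs.valid, hs.cest, fun _ => ⟨v, rfl⟩, by simp, by simp, by simp [InRound]⟩
  | filt2_adopt C v hl hC hQ hW =>
    exact ⟨hs.valid, hs.cest, by simp, by simp,
      fun _ => .query_adopt p s.round C v hQ (hval hC) hW, by simp [InRound]⟩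
  | filt2_keep C hl hC hQ h1 h2 =>
    exact ⟨hs.valid, hs.cest, by simp, by simp,
      fun _ => .query_keep p s.round C s.estCert s.est hQ (hval hC) h1 h2
        (hs.query (.inr (.inr (.inr hl)))), by simp [InRound]⟩

theorem LState.Coherent.respondStep {t : ℕ} {p : Fin n} {q o : Msg n V} {s s' : LState n V}
    (hs : s.Coherent t p) (h : RespondStep p q s o s') : s'.Coherent t p := by
  cases h with
  | first hl hq hk =>
    refine ⟨hs.valid, ?_, hs.halted, hs.round_eq_zero, hs.next_query, hs.query⟩
    intro r b hb
    by_cases hr : r = q.round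
    · subst hr
      obtain rfl : q = b := by simpa using hb
      exact ⟨hq, hk, rfl⟩
    · exact hs.cest r b (by simpa [Function.update_of_ne hr] using hb)
  | again => exact ⟨hs.valid, hs.cest, hs.halted, hs.round_eq_zero, hs.next_query, hs.query⟩
  | other => exact ⟨hs.valid, hs.cest, hs.halted, hs.round_eq_zero, hs.next_query, hs.query⟩

/-- A message sent by the basic task is signed by its sender, valid, and certified by messages
the sender holds. -/
theorem LState.Coherent.mainStep_out {t : ℕ} {p : Fin n} {own : V} {now : ℝ} {s s' : LState n V}
    {m : Msg n V} (hs : s.Coherent t p) (h : MainStep t p own now s (some m) s') :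
    m.src = p ∧ Valid t m ∧ ∀ b ∈ m.cert, b ∈ s.estCert ∨ b ∈ s.rcvd := by
  have hval {C : List (Msg n V)} (hC : ∀ m ∈ C, m ∈ s.rcvd) : ∀ m ∈ C, Valid t m :=
    fun m hm => hs.valid m (hC m hm)
  cases h with
  | start hl => exact ⟨rfl, .init p own, by simp [Msg.cert]⟩
  | query c hl hc => exact ⟨rfl, hs.next_query hl, fun b hb => .inl hb⟩
  | response_val b hl hb hk hr hc =>
    exact ⟨rfl, .relay_val p _ b hk hr hc (hs.valid b hb), by simpa [Msg.cert] using .inr hb⟩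
  | response_bot C hl hno _ hC hQ =>
    refine ⟨rfl, .relay_bot p _ C hQ (hval hC) fun b hb hc => hno ⟨b, hC b hb, ?_⟩,
      fun b hb => .inr (hC b hb)⟩
    exact ⟨(hQ.2.2 b hb).1, (hQ.2.2 b hb).2, hc⟩
  | relay C a hl hC hQ ha => exact ⟨rfl, .filt1 p _ C a hQ (hval hC) ha, fun b hb => .inr (hC b hb)⟩
  | filt1 C a hl hC hQ ha => exact ⟨rfl, .filt2 p _ C a hQ (hval hC) ha, fun b hb => .inr (hC b hb)⟩
  | filt2_decide C v hl hC hQ hW =>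
    exact ⟨rfl, .dec p _ C v hQ (hval hC) hW, fun b hb => .inr (hC b hb)⟩

theorem LState.Coherent.respondStep_out {t : ℕ} {p : Fin n} {q o : Msg n V} {s s' : LState n V}
    (hs : s.Coherent t p) (h : RespondStep p q s o s') :
    o.src = p ∧ Valid t o ∧ ∀ b ∈ o.cert, b ∈ s.rcvd := by
  cases h with
  | first hl hq hk _ hc =>
    exact ⟨rfl, .response_coord p _ q hc hk rfl (hs.valid q hq), by simpa [Msg.cert] using hq⟩
  | again q₀ hl hq hk _ hc hq₀ =>
    obtain ⟨h1, h2, h3⟩ := hs.cest _ _ hq₀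
    exact ⟨rfl, .response_coord p _ q₀ hc h2 h3 (hs.valid q₀ h1), by simpa [Msg.cert] using h1⟩
  | other hl hq hk _ hc => exact ⟨rfl, .response_other p _ _ hc, by simp [Msg.cert]⟩

theorem RespondStep.kind_round {p : Fin n} {q o : Msg n V} {s s' : LState n V}
    (h : RespondStep p q s o s') : o.kind = .response ∧ o.round = q.round := by
  cases h <;> exact ⟨rfl, rfl⟩

/-- Answering a query leaves everything but the bookkeeping of the query-response task alone. -/
theorem RespondStep.frame {p : Fin n} {q o : Msg n V} {s s' : LState n V}
    (h : RespondStep p q s o s') :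
    ∃ A c, s' = { s with answered := A, cest := c } ∧ ∀ r b, s.cest r = some b → c r = some b := by
  cases h with
  | first hl hq hk _ hc hno =>
    refine ⟨_, _, rfl, fun r b hb => ?_⟩
    have hr : r ≠ q.round := by
      rintro rfl
      simp [hno] at hb
    simpa [Function.update_of_ne hr] using hb
  | again => exact ⟨_, s.cest, rfl, fun _ _ h => h⟩
  | other => exact ⟨_, s.cest, rfl, fun _ _ h => h⟩

theorem MainStep.rcvd_eq {t : ℕ} {p : Fin n} {own : V} {now : ℝ} {s s' : LState n V}
    {o : Option (Msg n V)} (h : MainStep t p own now s o s') : s'.rcvd = s.rcvd := by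
  cases h <;> rfl

theorem MainStep.cest_eq {t : ℕ} {p : Fin n} {own : V} {now : ℝ} {s s' : LState n V}
    {o : Option (Msg n V)} (h : MainStep t p own now s o s') : s'.cest = s.cest := by
  cases h <;> rfl

theorem MainStep.round_le {t : ℕ} {p : Fin n} {own : V} {now : ℝ} {s s' : LState n V}
    {o : Option (Msg n V)} (h : MainStep t p own now s o s') : s.round ≤ s'.round := by
  cases h <;> simp

theorem LState.le_newDelta (s : LState n V) : s.delta ≤ s.newDelta := by
  intro c
  simp only [LState.newDelta]
  split_ifs <;> simp

theorem MainStep.delta_le {t : ℕ} {p : Fin n} {own : V} {now : ℝ} {s s' : LState n V}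
    {o : Option (Msg n V)} (h : MainStep t p own now s o s') : s.delta ≤ s'.delta := by
  cases h <;> first | exact le_rfl | exact s.le_newDelta

/-! ### Transitions seen from one correct process -/

namespace Trace

/-- What the transition at point `k` is for the correct process `p`: either `p` neither moves nor
sends anything, or one of its tasks or its input link is active. -/
inductive ProcStep (ρ : Trace n V) (t : ℕ) (own : V) (k : ℕ) (p : Fin n) : Prop
  | silent : ρ.state (k + 1) p = ρ.state k p → (∀ q m, ¬ ρ.Sends k p q m) → ProcStep ρ t own k p
  | receive (i : ℕ) (q : Fin n) (m : Msg n V) : i < k → ρ.Sends i q p m →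
      ρ.state (k + 1) p = (ρ.state k p).accept t q m → (∀ q m, ¬ ρ.Sends k p q m) →
      ProcStep ρ t own k p
  | main (o : Option (Msg n V)) (s' : LState n V) : ρ.act k = .main p →
      MainStep t p own (ρ.time k) (ρ.state k p) o s' → ρ.out k = (fun _ => o) →
      ρ.state (k + 1) p = s' → ProcStep ρ t own k p
  | expire : (ρ.state k p).loc = .waitResponse → (ρ.state k p).deadline ≤ ρ.time k →
      ρ.state (k + 1) p = { ρ.state k p with expired := true } → (∀ q m, ¬ ρ.Sends k p q m) →
      ProcStep ρ t own k p
  | respond (q o : Msg n V) (s' : LState n V) : ρ.act k = .respond p q →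
      RespondStep p q (ρ.state k p) o s' →
      ρ.out k = (fun j => if j = q.src then some o else none) →
      ρ.state (k + 1) p = s' → ProcStep ρ t own k p
  | decide (m : Msg n V) : ρ.act k = .decide p m → m ∈ (ρ.state k p).rcvd →
      m.kind = .dec → ρ.out k = (fun _ => some (.mk .dec p 0 m.val m.cert)) →
      ρ.state (k + 1) p = { ρ.state k p with loc := .halted, decision := m.val } →
      ProcStep ρ t own k p

variable {ρ : Trace n V} {t : ℕ} {F : Finset (Fin n)} {input : Fin n → V}

theorem IsRun.procStep (hρ : ρ.IsRun t F input) {p : Fin n} (hp : p ∉ F) (k : ℕ) :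
    ρ.ProcStep t (input p) k p := by
  have h := hρ.step k
  unfold StepOK at h
  have hsilent : ∀ a, ρ.act k = a → a.actor ≠ some p → ∀ q m, ¬ ρ.Sends k p q m := by
    rintro a rfl ha q m hm
    exact ha hm.1
  cases hact : ρ.act k with
  | idle =>
    rw [hact] at h
    exact .silent (by rw [h.2]) (hsilent _ hact (by simp [Action.actor]))
  | receive i q =>
    rw [hact] at h
    have hno := hsilent _ hact (by simp [Action.actor])
    obtain ⟨hi, -, -, p', m, hm, hs⟩ := h
    by_cases hq : q ∈ F
    · rw [if_pos hq] at hs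
      exact .silent (by rw [hs]) hno
    · rw [if_neg hq] at hs
      by_cases hqp : p = q
      · subst hqp
        exact .receive i p' m hi hm (by rw [hs, Function.update_self]) hno
      · exact .silent (by rw [hs, Function.update_of_ne hqp]) hno
  | main q =>
    rw [hact] at h
    obtain ⟨-, o, s', h1, h2, h3⟩ := h
    by_cases hqp : p = q
    · subst hqp
      exact .main o s' hact h1 h2 (by rw [h3, Function.update_self])
    · exact .silent (by rw [h3, Function.update_of_ne hqp])
        (hsilent _ hact (by simpa [Action.actor] using Ne.symm hqp))
  | expire q =>
    rw [hact] at h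
    obtain ⟨-, h1, -, h2, h3, h4⟩ := h
    by_cases hqp : p = q
    · subst hqp
      refine .expire h1 h2 (by rw [h4, Function.update_self]) fun q m hm => ?_
      simp [Sends, h3] at hm
    · exact .silent (by rw [h4, Function.update_of_ne hqp])
        (hsilent _ hact (by simpa [Action.actor] using Ne.symm hqp))
  | respond q m =>
    rw [hact] at h
    obtain ⟨-, o, s', h1, h2, h3⟩ := h
    by_cases hqp : p = q
    · subst hqp
      exact .respond m o s' hact h1 h2 (by rw [h3, Function.update_self])
    · exact .silent (by rw [h3, Function.update_of_ne hqp])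
        (hsilent _ hact (by simpa [Action.actor] using Ne.symm hqp))
  | decide q m =>
    rw [hact] at h
    obtain ⟨-, h0, h1, h2, h3, h4⟩ := h
    by_cases hqp : p = q
    · subst hqp
      exact .decide m hact h1 h2 h3 (by rw [h4, Function.update_self])
    · exact .silent (by rw [h4, Function.update_of_ne hqp])
        (hsilent _ hact (by simpa [Action.actor] using Ne.symm hqp))
  | byz q =>
    rw [hact] at h
    have hqp : q ≠ p := fun e => hp (e ▸ h.1)
    exact .silent (by rw [h.2.1]) (hsilent _ hact (by simpa [Action.actor] using hqp))

theorem IsRun.coherent (hρ : ρ.IsRun t F input) {p : Fin n} (hp : p ∉ F) (k : ℕ) :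
    (ρ.state k p).Coherent t p := by
  induction k with
  | zero => rw [hρ.initial]; exact LState.coherent_initial t p _
  | succ k ih =>
    cases hρ.procStep hp k with
    | silent hs => rwa [hs]
    | receive i q m _ _ hs => rw [hs]; exact ih.accept q m
    | main o s' _ h _ hs => rw [hs]; exact ih.mainStep h
    | expire _ _ hs =>
      rw [hs]
      exact ⟨ih.valid, ih.cest, ih.halted, ih.round_eq_zero, ih.next_query, ih.query⟩
    | respond q o s' _ h _ hs => rw [hs]; exact ih.respondStep h
    | decide m _ hm hk _ hs =>
      rw [hs]
      exact ⟨ih.valid, ih.cest, fun _ => (ih.valid m hm).exists_val_of_dec hk, by simp, by simp,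
        by simp [LState.InRound]⟩

theorem IsRun.monotone_rcvd (hρ : ρ.IsRun t F input) {p : Fin n} (hp : p ∉ F) :
    Monotone fun k => (ρ.state k p).rcvd := by
  refine monotone_nat_of_le_succ fun k => ?_
  cases hρ.procStep hp k with
  | silent hs => simp [hs]
  | receive i q m _ _ hs =>
    simp only [hs]
    rcases (ρ.state k p).accept_cases t q m with h | ⟨-, -, h⟩ <;> rw [h]
    exact Set.subset_insert _ _
  | main o s' _ h _ hs => simp [hs, h.rcvd_eq]
  | expire _ _ hs => simp [hs]
  | respond q o s' _ h _ hs =>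
    obtain ⟨A, c, rfl, -⟩ := h.frame
    simp [hs]
  | decide m _ _ _ _ hs => simp [hs]

theorem IsRun.monotone_round (hρ : ρ.IsRun t F input) {p : Fin n} (hp : p ∉ F) :
    Monotone fun k => (ρ.state k p).round := by
  refine monotone_nat_of_le_succ fun k => ?_
  cases hρ.procStep hp k with
  | silent hs => simp [hs]
  | receive i q m _ _ hs =>
    simp only [hs]
    rcases (ρ.state k p).accept_cases t q m with h | ⟨-, -, h⟩ <;> rw [h]
  | main o s' _ h _ hs => simpa [hs] using h.round_le
  | expire _ _ hs => simp [hs]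
  | respond q o s' _ h _ hs =>
    obtain ⟨A, c, rfl, -⟩ := h.frame
    simp [hs]
  | decide m _ _ _ _ hs => simp [hs]

theorem IsRun.monotone_delta (hρ : ρ.IsRun t F input) {p : Fin n} (hp : p ∉ F) :
    Monotone fun k => (ρ.state k p).delta := by
  refine monotone_nat_of_le_succ fun k => ?_
  cases hρ.procStep hp k with
  | silent hs => simp [hs]
  | receive i q m _ _ hs =>
    simp only [hs]
    rcases (ρ.state k p).accept_cases t q m with h | ⟨-, -, h⟩ <;> rw [h]
  | main o s' _ h _ hs => simpa [hs] using h.delta_le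
  | expire _ _ hs => simp [hs]
  | respond q o s' _ h _ hs =>
    obtain ⟨A, c, rfl, -⟩ := h.frame
    simp [hs]
  | decide m _ _ _ _ hs => simp [hs]

/-- The coordination value of a round is fixed once and for all. -/
theorem IsRun.cest_mono (hρ : ρ.IsRun t F input) {p : Fin n} (hp : p ∉ F) {i j : ℕ}
    (hij : i ≤ j) {r : ℕ} {b : Msg n V} (hb : (ρ.state i p).cest r = some b) :
    (ρ.state j p).cest r = some b := by
  induction j, hij using Nat.le_induction with
  | base => exact hb
  | succ k _ ih =>
    cases hρ.procStep hp k with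
    | silent hs => rwa [hs]
    | receive i q m _ _ hs =>
      rw [hs]
      rcases (ρ.state k p).accept_cases t q m with h | ⟨-, -, h⟩ <;> rw [h] <;> exact ih
    | main o s' _ h _ hs => rwa [hs, h.cest_eq]
    | expire _ _ hs => rwa [hs]
    | respond q o s' _ h _ hs =>
      obtain ⟨A, c, rfl, hc⟩ := h.frame
      rw [hs]
      exact hc r b ih
    | decide m _ _ _ _ hs => rwa [hs]

/-- Only the basic task changes the control location and the round of a process that does not
halt. -/
theorem IsRun.loc_round_eq (hρ : ρ.IsRun t F input) {p : Fin n} (hp : p ∉ F) {k : ℕ}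
    (hk : ρ.act k ≠ .main p) (hh : (ρ.state (k + 1) p).loc ≠ .halted) :
    (ρ.state (k + 1) p).loc = (ρ.state k p).loc ∧
      (ρ.state (k + 1) p).round = (ρ.state k p).round := by
  cases hρ.procStep hp k with
  | silent hs => simp [hs]
  | receive i q m _ _ hs =>
    rw [hs]
    rcases (ρ.state k p).accept_cases t q m with h | ⟨-, -, h⟩ <;> rw [h] <;> exact ⟨rfl, rfl⟩
  | main o s' ha => exact (hk ha).elim
  | expire _ _ hs => rw [hs]; exact ⟨rfl, rfl⟩
  | respond q o s' _ h _ hs =>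
    obtain ⟨A, c, rfl, -⟩ := h.frame
    rw [hs]; exact ⟨rfl, rfl⟩
  | decide m _ _ _ _ hs => simp [hs] at hh

/-- A step of the basic task of a correct process, with the data of the trace filled in. -/
theorem IsRun.mainStep (hρ : ρ.IsRun t F input) {p : Fin n} {k : ℕ} (hk : ρ.act k = .main p) :
    ∃ o, MainStep t p (input p) (ρ.time k) (ρ.state k p) o (ρ.state (k + 1) p) ∧
      ρ.out k = fun _ => o := by
  have h := hρ.step k
  unfold StepOK at h
  rw [hk] at h
  obtain ⟨-, o, s', h1, h2, h3⟩ := h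
  refine ⟨o, ?_, h2⟩
  rwa [h3, Function.update_self]

/-- A correct process signs what it sends, sends only valid messages, and certifies them with
messages that it holds. -/
theorem IsRun.sends_correct (hρ : ρ.IsRun t F input) {p q : Fin n} (hp : p ∉ F) {k : ℕ}
    {m : Msg n V} (hm : ρ.Sends k p q m) :
    m.src = p ∧ Valid t m ∧ ∀ b ∈ m.cert, b ∈ (ρ.state k p).estCert ∨ b ∈ (ρ.state k p).rcvd ∨
      ∃ b' ∈ (ρ.state k p).rcvd, b ∈ b'.cert := by
  have hco := hρ.coherent hp k
  cases hρ.procStep hp k with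
  | silent _ h => exact (h q m hm).elim
  | receive _ _ _ _ _ _ h => exact (h q m hm).elim
  | main o s' _ h hout =>
    have ho : o = some m := by rw [← hm.2, hout]
    subst ho
    obtain ⟨h1, h2, h3⟩ := hco.mainStep_out h
    exact ⟨h1, h2, fun b hb => (h3 b hb).imp_right .inl⟩
  | expire _ _ _ h => exact (h q m hm).elim
  | respond b o s' _ h hout =>
    have ho := hm.2
    rw [hout] at ho
    obtain rfl : o = m := by
      by_contra hne
      simp only at ho
      split_ifs at ho
      exact hne (Option.some_injective _ ho)
    obtain ⟨h1, h2, h3⟩ := hco.respondStep_out h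
    exact ⟨h1, h2, fun b hb => .inr (.inl (h3 b hb))⟩
  | decide b _ hb hk hout =>
    have ho := hm.2
    rw [hout] at ho
    obtain rfl := Option.some_injective _ ho
    exact ⟨rfl, (hco.valid b hb).forward_dec hk p, fun b' hb' => .inr (.inr ⟨b, hb, hb'⟩)⟩

/-! ### Unforgeability -/

/-- Before point `k`, every signed message of a correct process inside `m` has been sent by its
signer. -/
def Authentic (ρ : Trace n V) (F : Finset (Fin n)) (k : ℕ) (m : Msg n V) : Prop :=
  ∀ m', Msg.Sub m' m → m'.src ∉ F → ∃ i < k, ∃ q, ρ.Sends i m'.src q m'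

theorem Authentic.mono {i j : ℕ} {m : Msg n V} (h : ρ.Authentic F i m) (hij : i ≤ j) :
    ρ.Authentic F j m := by
  intro m' hm' hs
  obtain ⟨a, ha, hq⟩ := h m' hm' hs
  exact ⟨a, ha.trans_le hij, hq⟩

theorem Authentic.of_mem_cert {k : ℕ} {b m : Msg n V} (h : ρ.Authentic F k m) (hb : b ∈ m.cert) :
    ρ.Authentic F k b :=
  fun m' hm' => h m' (.cert hm' hb)

/-- The messages that `p` holds at point `k`, its certificate for its estimate included, are
authentic, and its current query, which may join that certificate, has been sent. -/
structure HoldsAuthentic (ρ : Trace n V) (F : Finset (Fin n)) (k : ℕ) (p : Fin n) : Prop where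
  rcvd : ∀ m ∈ (ρ.state k p).rcvd, ρ.Authentic F k m
  estCert : ∀ m ∈ (ρ.state k p).estCert, ρ.Authentic F k m
  query : (ρ.state k p).InRound → ∃ i < k, ∃ q,
    ρ.Sends i p q (.mk .query p (ρ.state k p).round (some (ρ.state k p).est)
      (ρ.state k p).estCert)

theorem IsRun.sends_authentic (hρ : ρ.IsRun t F input) {k : ℕ}
    (ih : ∀ p ∉ F, ρ.HoldsAuthentic F k p) {p q : Fin n} {m : Msg n V} (hm : ρ.Sends k p q m) :
    ρ.Authentic F (k + 1) m := by
  by_cases hp : p ∈ F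
  · have h := hρ.step k
    unfold StepOK at h
    have hact := hm.1
    cases ha : ρ.act k <;> rw [ha] at h hact <;> simp only [Action.actor, Option.some.injEq,
      reduceCtorEq] at hact <;> try exact (h.1 (hact ▸ hp)).elim
    intro m' hm' hs
    obtain ⟨i, hi, hq⟩ := h.2.2 q m hm.2 m' hm' hs
    exact ⟨i, hi.trans k.lt_succ_self, hq⟩
  · obtain ⟨hsrc, -, hcert⟩ := hρ.sends_correct hp hm
    intro m' hm' hs
    rcases hm'.eq_or_mem_cert with rfl | ⟨b, hb, hsub⟩
    · exact ⟨k, k.lt_succ_self, q, by rwa [hsrc]⟩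
    · have : ρ.Authentic F k b := by
        rcases hcert b hb with h | h | ⟨b', h, hb'⟩
        · exact (ih p hp).estCert b h
        · exact (ih p hp).rcvd b h
        · exact ((ih p hp).rcvd b' h).of_mem_cert hb'
      exact this.mono k.le_succ m' hsub hs

theorem HoldsAuthentic.congr {k : ℕ} {p : Fin n} (h : ρ.HoldsAuthentic F k p)
    (h1 : ∀ m ∈ (ρ.state (k + 1) p).rcvd, m ∈ (ρ.state k p).rcvd ∨ ρ.Authentic F k m)
    (h2 : (ρ.state (k + 1) p).estCert = (ρ.state k p).estCert)
    (h3 : (ρ.state (k + 1) p).InRound → (ρ.state k p).InRound ∧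
      (ρ.state (k + 1) p).round = (ρ.state k p).round ∧
      (ρ.state (k + 1) p).est = (ρ.state k p).est) :
    ρ.HoldsAuthentic F (k + 1) p := by
  refine ⟨fun m hm => ?_, fun m hm => ?_, fun hin => ?_⟩
  · rcases h1 m hm with hm | hm
    · exact (h.rcvd m hm).mono k.le_succ
    · exact hm.mono k.le_succ
  · rw [h2] at hm
    exact (h.estCert m hm).mono k.le_succ
  · obtain ⟨h4, h5, h6⟩ := h3 hin
    obtain ⟨i, hi, hq⟩ := h.query h4
    exact ⟨i, hi.trans k.lt_succ_self, by rwa [h2, h5, h6]⟩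

theorem IsRun.holdsAuthentic_succ (hρ : ρ.IsRun t F input) {k : ℕ} {p : Fin n} (hp : p ∉ F)
    (ih : ρ.HoldsAuthentic F k p)
    (hsent : ∀ i < k, ∀ p q m, ρ.Sends i p q m → ρ.Authentic F k m) :
    ρ.HoldsAuthentic F (k + 1) p := by
  cases hρ.procStep hp k with
  | silent hs => exact ih.congr (by simp [hs]; tauto) (by rw [hs]) (by simp [hs])
  | receive i q m hi hm hs =>
    rcases (ρ.state k p).accept_cases t q m with h | ⟨-, -, h⟩
    · rw [h] at hs
      exact ih.congr (by simp [hs]; tauto) (by rw [hs]) (by simp [hs])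
    · rw [h] at hs
      refine ih.congr (fun b hb => ?_) (by rw [hs]) (by simp [hs, LState.InRound])
      rw [hs] at hb
      rcases hb with rfl | hb
      · exact .inr (hsent i hi _ _ _ hm)
      · exact .inl hb
  | main o s' ha h hout hs =>
    have hC {C : List (Msg n V)} (hC : ∀ m ∈ C, m ∈ (ρ.state k p).rcvd) :
        ∀ m ∈ C, ρ.Authentic F (k + 1) m := fun m hm => (ih.rcvd m (hC m hm)).mono k.le_succ
    have hr : ∀ m ∈ (ρ.state (k + 1) p).rcvd, ρ.Authentic F (k + 1) m := by
      rw [hs, h.rcvd_eq]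
      exact fun m hm => (ih.rcvd m hm).mono k.le_succ
    have hr' : ∀ m ∈ (ρ.state (k + 1) p).rcvd, m ∈ (ρ.state k p).rcvd ∨ ρ.Authentic F k m := by
      rw [hs, h.rcvd_eq]
      exact fun m hm => .inl hm
    cases h with
    | start => exact ih.congr hr' (by rw [hs]) (by simp [hs, LState.InRound])
    | init C e _ hrC =>
      exact ⟨hr, by rw [hs]; exact hC hrC, by simp [hs, LState.InRound]⟩
    | query c hl =>
      refine ⟨hr, ?_, fun _ => ⟨k, k.lt_succ_self, p, by rw [ha]; rfl, ?_⟩⟩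
      · rw [hs]
        exact fun m hm => (ih.estCert m hm).mono k.le_succ
      · rw [hout, hs]
    | response_val _ hl =>
      exact ih.congr hr' (by rw [hs]) (by simp [hs, LState.InRound, hl])
    | response_bot _ hl =>
      exact ih.congr hr' (by rw [hs]) (by simp [hs, LState.InRound, hl])
    | relay _ _ hl => exact ih.congr hr' (by rw [hs]) (by simp [hs, LState.InRound, hl])
    | filt1 _ _ hl => exact ih.congr hr' (by rw [hs]) (by simp [hs, LState.InRound, hl])
    | filt2_decide => exact ih.congr hr' (by rw [hs]) (by simp [hs, LState.InRound])
    | filt2_adopt C v _ hrC =>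
      exact ⟨hr, by rw [hs]; exact hC hrC, by simp [hs, LState.InRound]⟩
    | filt2_keep C hl hrC =>
      refine ⟨hr, ?_, by simp [hs, LState.InRound]⟩
      rw [hs]
      intro m hm
      rcases List.mem_cons.1 hm with rfl | hm
      · obtain ⟨i, hi, q, hq⟩ := ih.query (.inr (.inr (.inr hl)))
        exact (hsent i hi _ _ _ hq).mono k.le_succ
      · exact hC hrC m hm
  | expire _ _ hs =>
    exact ih.congr (by simp [hs]; tauto) (by rw [hs]) (by simp [hs, LState.InRound])
  | respond q o s' _ h _ hs =>
    obtain ⟨A, c, rfl, -⟩ := h.frame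
    exact ih.congr (by simp [hs]; tauto) (by rw [hs]) (by simp [hs, LState.InRound])
  | decide m _ _ _ _ hs =>
    exact ih.congr (by simp [hs]; tauto) (by rw [hs]) (by simp [hs, LState.InRound])

/-- What a correct process holds and what anybody sends are shown to be authentic by one induction:
messages are sent with certificates made of held messages, and are held after they were sent. -/
theorem IsRun.holdsAuthentic_and_sends (hρ : ρ.IsRun t F input) (k : ℕ) :
    (∀ p ∉ F, ρ.HoldsAuthentic F k p) ∧
      ∀ i < k, ∀ p q m, ρ.Sends i p q m → ρ.Authentic F k m := by
  induction k with
  | zero =>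
    refine ⟨fun p _ => ?_, by simp⟩
    constructor <;> simp [hρ.initial, LState.initial, LState.InRound]
  | succ k ih =>
    refine ⟨fun p hp => hρ.holdsAuthentic_succ hp (ih.1 p hp) ih.2, fun i hi p q m hm => ?_⟩
    rcases Nat.lt_succ_iff_lt_or_eq.1 hi with hi | rfl
    · exact (ih.2 i hi p q m hm).mono k.le_succ
    · exact hρ.sends_authentic ih.1 hm

/-- Unforgeability: a correct process only holds authentic messages. -/
theorem IsRun.authentic (hρ : ρ.IsRun t F input) {p : Fin n} (hp : p ∉ F) {k : ℕ} {m : Msg n V}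
    (hm : m ∈ (ρ.state k p).rcvd) : ρ.Authentic F k m :=
  ((hρ.holdsAuthentic_and_sends k).1 p hp).rcvd m hm

theorem Authentic.exists_sends {k : ℕ} {m : Msg n V} (h : ρ.Authentic F k m) (hm : m.src ∉ F) :
    ∃ i < k, ∃ q, ρ.Sends i m.src q m :=
  h m (.refl m) hm

/-! ### What correct processes have sent -/

theorem sends_of_main {k : ℕ} {p q : Fin n} {m : Msg n V} (ha : ρ.act k = .main p)
    (ho : ρ.out k = fun _ => some m) : ρ.Sends k p q m :=
  ⟨by rw [ha]; rfl, by rw [ho]⟩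

theorem IsRun.exists_sent (hρ : ρ.IsRun t F input) {p : Fin n} (hp : p ∉ F) {k : ℕ} {κ : Kind}
    (hk : (ρ.state k p).loc.sent = some κ) :
    ∃ i < k, ∃ m : Msg n V, m.kind = κ ∧ m.round = (ρ.state k p).round ∧
      ∀ q, ρ.Sends i p q m := by
  induction k with
  | zero => simp [hρ.initial, LState.initial, Loc.sent] at hk
  | succ k ih =>
    by_cases ha : ρ.act k = .main p
    · obtain ⟨o, h, ho⟩ := hρ.mainStep ha
      have hz := (hρ.coherent hp k).round_eq_zero
      generalize hs' : ρ.state (k + 1) p = s' at h hk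
      refine ⟨k, k.lt_succ_self, ?_⟩
      cases h with
      | start hl =>
        exact ⟨.mk .init p 0 (some (input p)) [], Option.some_injective _ hk,
          (hz (.inl hl)).symm, fun q => sends_of_main ha ho⟩
      | init | filt2_adopt | filt2_keep | filt2_decide => simp [Loc.sent] at hk
      | _ => exact ⟨.mk _ _ _ _ _, Option.some_injective _ hk, rfl, fun q => sends_of_main ha ho⟩
    · have hh : (ρ.state (k + 1) p).loc ≠ .halted := fun e => by simp [e, Loc.sent] at hk
      obtain ⟨h1, h2⟩ := hρ.loc_round_eq hp ha hh
      rw [h1] at hk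
      rw [h2]
      obtain ⟨i, hi, h⟩ := ih hk
      exact ⟨i, hi.trans k.lt_succ_self, h⟩

theorem IsRun.sends_query (hρ : ρ.IsRun t F input) {p q : Fin n} (hp : p ∉ F) {k : ℕ}
    {m : Msg n V} (hm : ρ.Sends k p q m) (hκ : m.kind = .query) :
    (ρ.state (k + 1) p).round = m.round := by
  have hout := hm.2
  cases hρ.procStep hp k with
  | silent _ h => exact (h q m hm).elim
  | receive _ _ _ _ _ _ h => exact (h q m hm).elim
  | main o s' _ h ho hs =>
    rw [ho] at hout
    simp only at hout
    subst hout
    rw [hs]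
    cases h with
    | query => rfl
    | _ => simp [Msg.kind] at hκ
  | expire _ _ _ h => exact (h q m hm).elim
  | respond b o s' _ h ho =>
    rw [ho] at hout
    simp only [Option.ite_none_right_eq_some, Option.some.injEq] at hout
    obtain ⟨-, rfl⟩ := hout
    simp [h.kind_round.1] at hκ
  | decide b _ _ _ ho =>
    rw [ho] at hout
    obtain rfl := Option.some_injective _ hout
    simp [Msg.kind] at hκ

/-- Queries of late rounds are issued late. -/
theorem IsRun.le_of_round_lt (hρ : ρ.IsRun t F input) {p q : Fin n} (hp : p ∉ F) {k K : ℕ}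
    {m : Msg n V} (hm : ρ.Sends k p q m) (hκ : m.kind = .query)
    (hr : (ρ.state K p).round < m.round) : K ≤ k := by
  by_contra! hlt
  have := hρ.monotone_round hp (Nat.succ_le_of_lt hlt)
  rw [← hρ.sends_query hp hm hκ] at hr
  exact absurd hr (not_lt.2 this)

/-- At point `k`, process `q` ends its wait for responses without having a response of the
coordinator. -/
def GivesUp (ρ : Trace n V) (t k : ℕ) (q : Fin n) : Prop :=
  ρ.act k = .main q ∧ (ρ.state k q).loc = .waitResponse ∧ (ρ.state k q).expired = true ∧
    (¬ ∃ m ∈ (ρ.state k q).rcvd, m.kind = .response ∧ m.round = (ρ.state k q).round ∧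
      IsCoord n (ρ.state k q).round m.src) ∧
    ∃ C : List (Msg n V), (∀ m ∈ C, m ∈ (ρ.state k q).rcvd) ∧
      Quorum t .response (ρ.state k q).round C

/-- A correct process relays the value of the coordinator unless it gave up waiting for it. -/
theorem IsRun.sends_relay (hρ : ρ.IsRun t F input) {p q : Fin n} (hp : p ∉ F) {k : ℕ}
    {m : Msg n V} (hm : ρ.Sends k p q m) (hκ : m.kind = .relay) :
    m.round = (ρ.state k p).round ∧ (ρ.GivesUp t k p ∨
      ∃ b ∈ (ρ.state k p).rcvd, b.kind = .response ∧ b.round = m.round ∧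
        IsCoord n m.round b.src ∧ m.val = b.val) := by
  have hout := hm.2
  cases hρ.procStep hp k with
  | silent _ h => exact (h q m hm).elim
  | receive _ _ _ _ _ _ h => exact (h q m hm).elim
  | main o s' ha h ho hs =>
    rw [ho] at hout
    simp only at hout
    subst hout
    cases h with
    | response_val b hl hb h1 h2 h3 => exact ⟨rfl, .inr ⟨b, hb, h1, h2, h3, rfl⟩⟩
    | response_bot C hl hno he hC hQ => exact ⟨rfl, .inl ⟨ha, hl, he, hno, C, hC, hQ⟩⟩
    | _ => simp [Msg.kind] at hκ
  | expire _ _ _ h => exact (h q m hm).elim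
  | respond b o s' _ h ho =>
    rw [ho] at hout
    simp only [Option.ite_none_right_eq_some, Option.some.injEq] at hout
    obtain ⟨-, rfl⟩ := hout
    simp [h.kind_round.1] at hκ
  | decide b _ _ _ ho =>
    rw [ho] at hout
    obtain rfl := Option.some_injective _ hout
    simp [Msg.kind] at hκ

/-- A correct coordinator answers with the coordination value of the round. -/
theorem IsRun.sends_response (hρ : ρ.IsRun t F input) {p q : Fin n} (hp : p ∉ F) {k : ℕ}
    {m : Msg n V} (hm : ρ.Sends k p q m) (hκ : m.kind = .response) (hc : IsCoord n m.round p) :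
    ∃ q₀, (ρ.state (k + 1) p).cest m.round = some q₀ ∧ m.val = q₀.val := by
  have hout := hm.2
  cases hρ.procStep hp k with
  | silent _ h => exact (h q m hm).elim
  | receive _ _ _ _ _ _ h => exact (h q m hm).elim
  | main o s' ha h ho hs =>
    rw [ho] at hout
    simp only at hout
    subst hout
    cases h <;> simp [Msg.kind] at hκ
  | expire _ _ _ h => exact (h q m hm).elim
  | respond b o s' _ h ho hs =>
    rw [ho] at hout
    simp only [Option.ite_none_right_eq_some, Option.some.injEq] at hout
    obtain ⟨-, rfl⟩ := hout
    rw [hs]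
    cases h with
    | first => exact ⟨b, by simp [Msg.round], rfl⟩
    | again q₀ _ _ _ _ _ h => exact ⟨q₀, h, rfl⟩
    | other _ _ _ _ h => exact (h hc).elim
  | decide b _ _ _ ho =>
    rw [ho] at hout
    obtain rfl := Option.some_injective _ hout
    simp [Msg.kind] at hκ

/-- The point at which a waiting process issued its query, together with the state of the timer it
set there. -/
theorem IsRun.exists_issuesQuery (hρ : ρ.IsRun t F input) {p : Fin n} (hp : p ∉ F) {k : ℕ}
    (hk : (ρ.state k p).loc = .waitResponse) :
    ∃ i < k, ρ.IssuesQuery i p (ρ.state k p).round ∧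
      (∀ c, IsCoord n (ρ.state k p).round c →
        (ρ.state k p).deadline = ρ.time i + (ρ.state i p).delta c) ∧
      ((ρ.state k p).expired = true → ∃ j < k, (ρ.state k p).deadline ≤ ρ.time j) := by
  induction k with
  | zero => simp [hρ.initial, LState.initial] at hk
  | succ k ih =>
    have keep : (ρ.state k p).loc = .waitResponse →
        (ρ.state (k + 1) p).round = (ρ.state k p).round →
        (ρ.state (k + 1) p).deadline = (ρ.state k p).deadline →
        ((ρ.state (k + 1) p).expired = true → (ρ.state k p).expired = true ∨
          (ρ.state k p).deadline ≤ ρ.time k) →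
        ∃ i < k + 1, ρ.IssuesQuery i p (ρ.state (k + 1) p).round ∧
          (∀ c, IsCoord n (ρ.state (k + 1) p).round c →
            (ρ.state (k + 1) p).deadline = ρ.time i + (ρ.state i p).delta c) ∧
          ((ρ.state (k + 1) p).expired = true →
            ∃ j < k + 1, (ρ.state (k + 1) p).deadline ≤ ρ.time j) := by
      intro h1 h2 h3 h4
      obtain ⟨i, hi, h5, h6, h7⟩ := ih h1
      rw [h2, h3]
      refine ⟨i, hi.trans k.lt_succ_self, h5, h6, fun he => ?_⟩
      rcases h4 he with he | he
      · obtain ⟨j, hj, h⟩ := h7 he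
        exact ⟨j, hj.trans k.lt_succ_self, h⟩
      · exact ⟨k, k.lt_succ_self, he⟩
    cases hρ.procStep hp k with
    | silent hs => simp only [hs] at hk keep ⊢; exact keep hk trivial trivial .inl
    | receive i q m _ _ hs =>
      rcases (ρ.state k p).accept_cases t q m with h | ⟨-, -, h⟩ <;> rw [h] at hs <;>
        simp only [hs] at hk keep ⊢ <;> exact keep hk trivial trivial .inl
    | main o s' ha h ho hs =>
      rw [hs] at hk ⊢
      cases h with
      | query c hl hc =>
        refine ⟨k, k.lt_succ_self, ⟨ha, _, rfl, rfl, fun q => by rw [ho]⟩, fun c' hc' => ?_,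
          by simp⟩
        rw [hc'.eq hc]
      | _ => simp at hk
    | expire _ hd hs => simp only [hs] at hk keep ⊢; exact keep hk trivial trivial fun _ => .inr hd
    | respond q o s' _ h _ hs =>
      obtain ⟨A, c, rfl, -⟩ := h.frame
      simp only [hs] at hk keep ⊢; exact keep hk trivial trivial .inl
    | decide m _ _ _ _ hs => simp [hs] at hk

/-! ### Delivery -/

theorem IsRun.delivered (hρ : ρ.IsRun t F input) {p q : Fin n} (hp : p ∉ F) (hq : q ∉ F) {i : ℕ}
    {m : Msg n V} (hm : ρ.Sends i p q m) :
    ∃ k, i < k ∧ ρ.act k = .receive i q ∧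
      ∃ m' ∈ (ρ.state (k + 1) q).rcvd, m'.src = p ∧ m'.kind = m.kind ∧ m'.round = m.round := by
  obtain ⟨k, hk⟩ := hρ.reliable i p q m hq hm
  have h := hρ.step k
  unfold StepOK at h
  rw [hk] at h
  obtain ⟨hi, -, -, p', m', hm', hs⟩ := h
  rw [if_neg hq] at hs
  obtain rfl : p = p' := Option.some_injective _ (hm.1.symm.trans hm'.1)
  obtain rfl : m = m' := Option.some_injective _ (hm.2.symm.trans hm'.2)
  obtain ⟨hsrc, hv, -⟩ := hρ.sends_correct hp hm
  refine ⟨k, hi, hk, ?_⟩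
  rw [hs, Function.update_self]
  obtain ⟨b, hb, h1, h2, h3⟩ := (ρ.state k q).exists_mem_accept hsrc hv
  exact ⟨b, hb, h1.trans hsrc, h2, h3⟩

/-- Collection: if every correct process sends `p` a message of type `κ` and round `r`, then
eventually `p` holds a quorum of such messages. -/
theorem IsRun.eventually_quorum (hρ : ρ.IsRun t F input) (hF : F.card ≤ t) {p : Fin n}
    (hp : p ∉ F) {κ : Kind} {r : ℕ}
    (h : ∀ q ∉ F, ∃ i m, ρ.Sends i q p m ∧ m.kind = κ ∧ m.round = r) :
    ∀ᶠ k in Filter.atTop, ∃ C : List (Msg n V), (∀ m ∈ C, m ∈ (ρ.state k p).rcvd) ∧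
      Quorum t κ r C := by
  have h' : ∀ q : Fin n, ∀ᶠ k in Filter.atTop, q ∉ F →
      ∃ m ∈ (ρ.state k p).rcvd, m.src = q ∧ m.kind = κ ∧ m.round = r := by
    intro q
    by_cases hq : q ∈ F
    · exact .of_forall fun k hq' => (hq' hq).elim
    · obtain ⟨i, m, hm, rfl, rfl⟩ := h q hq
      obtain ⟨k, -, -, b, hb, h⟩ := hρ.delivered hq hp hm
      filter_upwards [Filter.eventually_ge_atTop (k + 1)] with j hj _
      exact ⟨b, hρ.monotone_rcvd hp hj hb, h⟩
  filter_upwards [Filter.eventually_all.2 h'] with k hk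
  exact exists_quorum hF hk

/-- The answer of the correct process `q` to a query of the correct process `p`, and how long after
the reception of the query it is sent. -/
theorem IsRun.exists_response (hρ : ρ.IsRun t F input) {φ : ℝ}
    (hφ : ∀ p, p ∉ F → ∀ k, ∀ m ∈ (ρ.state (k + 1) p).rcvd, m.kind = .query →
      ∃ j, ρ.time j ≤ ρ.time k + φ ∧
        (ρ.act j = .respond p m ∨ (ρ.state (j + 1) p).loc = .halted))
    {p q : Fin n} (hp : p ∉ F) (hq : q ∉ F) (hh : ∀ k, (ρ.state k q).loc ≠ .halted) {i : ℕ}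
    {m : Msg n V} (hm : ρ.Sends i p q m) (hκ : m.kind = .query) :
    ∃ k j o, ρ.act k = .receive i q ∧ ρ.time j ≤ ρ.time k + φ ∧ ρ.Sends j q p o ∧
      o.kind = .response ∧ o.round = m.round ∧
      ∃ i' < j, ∃ q' m', ρ.Sends i' p q' m' ∧ m'.kind = .query ∧ m'.round = m.round := by
  obtain ⟨k, -, hk, b, hb, rfl, h2, h3⟩ := hρ.delivered hp hq hm
  obtain ⟨j, hj, hact⟩ := hφ q hq k b hb (h2.trans hκ)
  replace hact := hact.resolve_right (hh _)
  have h := hρ.step j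
  unfold StepOK at h
  rw [hact] at h
  obtain ⟨-, o, s', h4, h5, -⟩ := h
  have hbj : b ∈ (ρ.state j q).rcvd := by cases h4 <;> assumption
  obtain ⟨i', hi', q', hs⟩ := (hρ.authentic hq hbj).exists_sends hp
  exact ⟨k, j, o, hk, hj, ⟨by rw [hact]; rfl, by simp [h5]⟩, h4.kind_round.1,
    h4.kind_round.2.trans h3, i', hi', q', b, hs, h2.trans hκ, h3⟩

/-! ### Progress -/

/-- Process `p` comes to the control location `l` in round `r`. -/
def Reaches (ρ : Trace n V) (p : Fin n) (l : Loc) (r : ℕ) : Prop :=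
  ∃ k, (ρ.state k p).loc = l ∧ (ρ.state k p).round = r

/-- A process that does not halt leaves every control location at which its basic task is
eventually enabled, by a step of that task. -/
theorem IsRun.exists_mainStep (hρ : ρ.IsRun t F input) {p : Fin n} (hp : p ∉ F)
    (hh : ∀ k, (ρ.state k p).loc ≠ .halted) {l : Loc} {r : ℕ} (hr : ρ.Reaches p l r)
    (hen : ∀ k, (ρ.state k p).loc = l → (ρ.state k p).round = r →
      (∀ j ≥ k, (ρ.state j p).loc = l ∧ (ρ.state j p).round = r) →
      ∃ j ≥ k, ∀ j' ≥ j, ρ.MainEnabled t input j' p) :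
    ∃ k o, (ρ.state k p).loc = l ∧ (ρ.state k p).round = r ∧
      MainStep t p (input p) (ρ.time k) (ρ.state k p) o (ρ.state (k + 1) p) := by
  obtain ⟨k, hl, hr⟩ := hr
  have stay : ∀ j ≥ k, (∀ i, k ≤ i → i < j → ρ.act i ≠ .main p) →
      (ρ.state j p).loc = l ∧ (ρ.state j p).round = r := by
    intro j hj
    induction j, hj using Nat.le_induction with
    | base => exact fun _ => ⟨hl, hr⟩
    | succ j hj ih =>
      intro h
      obtain ⟨h1, h2⟩ := hρ.loc_round_eq hp (h j hj j.lt_succ_self) (hh _)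
      rw [h1, h2]
      exact ih fun i hi hij => h i hi (hij.trans j.lt_succ_self)
  have hex : ∃ j, k ≤ j ∧ ρ.act j = .main p := by
    by_contra! hno
    obtain ⟨j, hj, hen⟩ := hen k hl hr fun j hj => stay j hj fun i hi _ => hno i hi
    obtain ⟨j', hj', h | h⟩ := hρ.main_fair p hp j (hen j le_rfl)
    · exact hno j' (hj.trans hj') h
    · exact h (hen j' hj')
  classical
  obtain ⟨h1, h2⟩ := stay _ (Nat.find_spec hex).1 fun i hi hlt h => Nat.find_min hex hlt ⟨hi, h⟩
  obtain ⟨o, h3, -⟩ := hρ.mainStep (Nat.find_spec hex).2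
  exact ⟨_, o, h1, h2, h3⟩

/-- A correct process that waits for the messages which all correct processes send on reaching its
control location eventually holds a quorum of them. -/
theorem IsRun.eventually_quorum_of_reaches (hρ : ρ.IsRun t F input) (hF : F.card ≤ t) {l : Loc}
    {r : ℕ} {κ : Kind} (hl : l.sent = some κ) (h : ∀ q ∉ F, ρ.Reaches q l r) {p : Fin n}
    (hp : p ∉ F) :
    ∀ᶠ k in Filter.atTop, ∃ C : List (Msg n V), (∀ m ∈ C, m ∈ (ρ.state k p).rcvd) ∧
      Quorum t κ r C := by
  refine hρ.eventually_quorum hF hp fun q hq => ?_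
  obtain ⟨k, rfl, rfl⟩ := h q hq
  obtain ⟨i, -, m, h1, h2, h3⟩ := hρ.exists_sent hq hl
  exact ⟨i, m, h3 p, h1, h2⟩

theorem IsRun.reaches_waitInit (hρ : ρ.IsRun t F input) {p : Fin n} (hp : p ∉ F)
    (hh : ∀ k, (ρ.state k p).loc ≠ .halted) : ρ.Reaches p .waitInit 0 := by
  obtain ⟨k, o, h1, h2, h3⟩ := hρ.exists_mainStep hp hh (l := .start) (r := 0)
    ⟨0, by simp [hρ.initial, LState.initial], by simp [hρ.initial, LState.initial]⟩
    fun k _ _ hst => ⟨k, le_rfl, fun j hj => ⟨_, _, .start (hst j hj).1⟩⟩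
  refine ⟨k + 1, ?_⟩
  generalize ρ.state (k + 1) p = s' at h3
  cases h3 <;> simp_all

theorem IsRun.reaches_newRound_zero (hρ : ρ.IsRun t F input) (hF : F.card ≤ t)
    (hh : ∀ p ∉ F, ∀ k, (ρ.state k p).loc ≠ .halted) {p : Fin n} (hp : p ∉ F) :
    ρ.Reaches p .newRound 0 := by
  have hall : ∀ q ∉ F, ρ.Reaches q .waitInit 0 := fun q hq => hρ.reaches_waitInit hq (hh q hq)
  obtain ⟨K, hK⟩ := Filter.eventually_atTop.1
    (hρ.eventually_quorum_of_reaches hF rfl hall hp)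
  obtain ⟨k, o, h1, h2, h3⟩ := hρ.exists_mainStep hp (hh p hp) (hall p hp) fun k _ _ hst =>
    ⟨max k K, le_max_left _ _, fun j hj => by
      obtain ⟨C, hC, hQ⟩ := hK j (le_of_max_le_right hj)
      obtain ⟨e, he⟩ := exists_initEst t C (input p)
      exact ⟨_, _, .init C e (hst j (le_of_max_le_left hj)).1 hC hQ he⟩⟩
  refine ⟨k + 1, ?_⟩
  generalize ρ.state (k + 1) p = s' at h3
  cases h3 <;> simp_all

theorem IsRun.reaches_waitResponse (hρ : ρ.IsRun t F input) (hn : 0 < n) {p : Fin n} (hp : p ∉ F)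
    (hh : ∀ k, (ρ.state k p).loc ≠ .halted) {r : ℕ} (h : ρ.Reaches p .newRound r) :
    ρ.Reaches p .waitResponse (r + 1) := by
  obtain ⟨k, o, h1, h2, h3⟩ := hρ.exists_mainStep hp hh h fun k _ _ hst =>
    ⟨k, le_rfl, fun j hj => by
      obtain ⟨c, hc⟩ := exists_isCoord hn ((ρ.state j p).round + 1)
      exact ⟨_, _, .query c (hst j hj).1 hc⟩⟩
  refine ⟨k + 1, ?_⟩
  generalize ρ.state (k + 1) p = s' at h3
  cases h3 <;> simp_all

theorem IsRun.reaches_waitRelay (hρ : ρ.IsRun t F input) (hF : F.card ≤ t)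
    (hh : ∀ p ∉ F, ∀ k, (ρ.state k p).loc ≠ .halted) {p : Fin n} (hp : p ∉ F) {r : ℕ}
    (h : ρ.Reaches p .waitResponse r) : ρ.Reaches p .waitRelay r := by
  obtain ⟨φ, hφ⟩ := hρ.respond_bound
  have hres : ∀ q ∉ F, ∃ i m, ρ.Sends i q p m ∧ m.kind = .response ∧ m.round = r := by
    intro q hq
    obtain ⟨k, h1, rfl⟩ := h
    obtain ⟨i, -, m, h2, h3, h4⟩ := hρ.exists_sent hp (k := k) (κ := .query) (by rw [h1]; rfl)
    obtain ⟨-, j, o, -, -, h5, h6, h7, -⟩ := hρ.exists_response hφ hp hq (hh q hq) (h4 q) h2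
    exact ⟨j, o, h5, h6, h7.trans h3⟩
  obtain ⟨K, hK⟩ := Filter.eventually_atTop.1 (hρ.eventually_quorum hF hp hres)
  obtain ⟨k, o, h1, h2, h3⟩ := hρ.exists_mainStep hp (hh p hp) h fun k hl hr hst => by
    obtain ⟨e, hek, he⟩ := hρ.timer_fair p hp k hl
    have he := he.resolve_right fun h => h (hst e hek).1
    -- The flag of an expired timer is only reset by the next query.
    have hexp : ∀ j ≥ e, (ρ.state j p).expired = true := by
      intro j hj
      induction j, hj using Nat.le_induction with
      | base => exact he
      | succ j hj ih =>
        have hl' := (hst j (hek.trans hj)).1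
        have hl'' := (hst (j + 1) (hek.trans (hj.trans j.le_succ))).1
        cases hρ.procStep hp j with
        | silent hs => rwa [hs]
        | receive i q m _ _ hs =>
          rw [hs]
          rcases (ρ.state j p).accept_cases t q m with h | ⟨-, -, h⟩ <;> rw [h] <;> exact ih
        | main o s' ha h ho hs =>
          rw [hs] at hl''
          cases h <;> simp_all
        | expire _ _ hs => rw [hs]
        | respond q o s' _ h _ hs =>
          obtain ⟨A, c, rfl, -⟩ := h.frame
          rw [hs]; exact ih
        | decide m _ _ _ _ hs => simp [hs] at hl''
    refine ⟨max e K, hek.trans (le_max_left _ _), fun j hj => ?_⟩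
    obtain ⟨hlj, hrj⟩ := hst j (hek.trans (le_of_max_le_left hj))
    by_cases hc : ∃ m ∈ (ρ.state j p).rcvd, m.kind = .response ∧
        m.round = (ρ.state j p).round ∧ IsCoord n (ρ.state j p).round m.src
    · obtain ⟨m, hm, h1, h2, h3⟩ := hc
      exact ⟨_, _, .response_val m hlj hm h1 h2 h3⟩
    · obtain ⟨C, hC, hQ⟩ := hK j (le_of_max_le_right hj)
      exact ⟨_, _, .response_bot C hlj hc (hexp j (le_of_max_le_left hj)) hC (by rwa [hrj])⟩
  refine ⟨k + 1, ?_⟩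
  generalize ρ.state (k + 1) p = s' at h3
  cases h3 <;> simp_all

theorem IsRun.reaches_waitFilt1 (hρ : ρ.IsRun t F input) (hF : F.card ≤ t)
    (hh : ∀ p ∉ F, ∀ k, (ρ.state k p).loc ≠ .halted) {r : ℕ}
    (hall : ∀ q ∉ F, ρ.Reaches q .waitRelay r) {p : Fin n} (hp : p ∉ F) :
    ρ.Reaches p .waitFilt1 r := by
  obtain ⟨K, hK⟩ := Filter.eventually_atTop.1
    (hρ.eventually_quorum_of_reaches hF rfl hall hp)
  obtain ⟨k, o, h1, h2, h3⟩ := hρ.exists_mainStep hp (hh p hp) (hall p hp) fun k _ _ hst =>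
    ⟨max k K, le_max_left _ _, fun j hj => by
      obtain ⟨C, hC, hQ⟩ := hK j (le_of_max_le_right hj)
      obtain ⟨a, ha⟩ := exists_relayOut (vals C)
      obtain ⟨hl, rfl⟩ := hst j (le_of_max_le_left hj)
      exact ⟨_, _, .relay C a hl hC hQ ha⟩⟩
  refine ⟨k + 1, ?_⟩
  generalize ρ.state (k + 1) p = s' at h3
  cases h3 <;> simp_all

theorem IsRun.reaches_waitFilt2 (hρ : ρ.IsRun t F input) (hF : F.card ≤ t)
    (hh : ∀ p ∉ F, ∀ k, (ρ.state k p).loc ≠ .halted) {r : ℕ}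
    (hall : ∀ q ∉ F, ρ.Reaches q .waitFilt1 r) {p : Fin n} (hp : p ∉ F) :
    ρ.Reaches p .waitFilt2 r := by
  obtain ⟨K, hK⟩ := Filter.eventually_atTop.1
    (hρ.eventually_quorum_of_reaches hF rfl hall hp)
  obtain ⟨k, o, h1, h2, h3⟩ := hρ.exists_mainStep hp (hh p hp) (hall p hp) fun k _ _ hst =>
    ⟨max k K, le_max_left _ _, fun j hj => by
      obtain ⟨C, hC, hQ⟩ := hK j (le_of_max_le_right hj)
      obtain ⟨a, ha⟩ := exists_filtOut (vals C)
      obtain ⟨hl, rfl⟩ := hst j (le_of_max_le_left hj)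
      exact ⟨_, _, .filt1 C a hl hC hQ ha⟩⟩
  refine ⟨k + 1, ?_⟩
  generalize ρ.state (k + 1) p = s' at h3
  cases h3 <;> simp_all

/-- The last step of a round of a process that does not halt: it did not find a single proper value
in the quorum it collected. -/
theorem IsRun.exists_filt2_step (hρ : ρ.IsRun t F input) (hF : F.card ≤ t)
    (hh : ∀ p ∉ F, ∀ k, (ρ.state k p).loc ≠ .halted) {r : ℕ}
    (hall : ∀ q ∉ F, ρ.Reaches q .waitFilt2 r) {p : Fin n} (hp : p ∉ F) :
    ρ.Reaches p .newRound r ∧ ∃ k, ∃ C : List (Msg n V), (∀ m ∈ C, m ∈ (ρ.state k p).rcvd) ∧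
      Quorum t .filt2 r C ∧ ¬ ∃ v, vals C = {some v} := by
  obtain ⟨K, hK⟩ := Filter.eventually_atTop.1
    (hρ.eventually_quorum_of_reaches hF rfl hall hp)
  obtain ⟨k, o, h1, h2, h3⟩ := hρ.exists_mainStep hp (hh p hp) (hall p hp) fun k _ _ hst =>
    ⟨max k K, le_max_left _ _, fun j hj => by
      obtain ⟨C, hC, hQ⟩ := hK j (le_of_max_le_right hj)
      obtain ⟨hl, rfl⟩ := hst j (le_of_max_le_left hj)
      by_cases hv : ∃ v, vals C = {some v}
      · exact ⟨_, _, .filt2_decide C hv.choose hl hC hQ hv.choose_spec⟩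
      by_cases hv' : ∃ v, vals C = {some v, none}
      · exact ⟨_, _, .filt2_adopt C hv'.choose hl hC hQ hv'.choose_spec⟩
      · exact ⟨_, _, .filt2_keep C hl hC hQ hv hv'⟩⟩
  have hne := hh p hp (k + 1)
  unfold Reaches
  generalize hs : ρ.state (k + 1) p = s' at h3 hne
  subst h2
  cases h3 with
  | filt2_decide => exact (hne rfl).elim
  | filt2_adopt C v hl hC hQ hW =>
    refine ⟨⟨k + 1, by rw [hs], by rw [hs]⟩, k, C, hC, hQ, ?_⟩
    rintro ⟨w, hw⟩
    have : (none : Option V) ∈ ({some w} : Set (Option V)) := by rw [← hw, hW]; simp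
    simp at this
  | filt2_keep C hl hC hQ hv => exact ⟨⟨k + 1, by rw [hs], by rw [hs]⟩, k, C, hC, hQ, hv⟩
  | _ => simp_all

/-- As long as nobody halts, all correct processes complete all rounds. -/
theorem IsRun.reaches_newRound (hρ : ρ.IsRun t F input) (hn : 0 < n) (hF : F.card ≤ t)
    (hh : ∀ p ∉ F, ∀ k, (ρ.state k p).loc ≠ .halted) (r : ℕ) :
    ∀ p ∉ F, ρ.Reaches p .newRound r := by
  induction r with
  | zero => exact fun p hp => hρ.reaches_newRound_zero hF hh hp
  | succ r ih =>
    intro p hp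
    exact (hρ.exists_filt2_step hF hh (fun q hq => hρ.reaches_waitFilt2 hF hh
      (fun q hq => hρ.reaches_waitFilt1 hF hh (fun q hq => hρ.reaches_waitRelay hF hh hq
        (hρ.reaches_waitResponse hn hq (hh q hq) (ih q hq))) hq) hq) hp).1

/-! ### Decision messages spread -/

theorem IsRun.exists_sends_dec (hρ : ρ.IsRun t F input) {p : Fin n} (hp : p ∉ F) {k : ℕ}
    (hk : (ρ.state k p).loc = .halted) :
    ∃ i, ∃ m : Msg n V, m.kind = .dec ∧ ∀ q, ρ.Sends i p q m := by
  induction k with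
  | zero => simp [hρ.initial, LState.initial] at hk
  | succ k ih =>
    by_cases hk' : (ρ.state k p).loc = .halted
    · exact ih hk'
    cases hρ.procStep hp k with
    | silent hs => exact (hk' (by rwa [hs] at hk)).elim
    | receive i q m _ _ hs =>
      rw [hs] at hk
      rcases (ρ.state k p).accept_cases t q m with h | ⟨-, -, h⟩ <;> rw [h] at hk <;>
        exact (hk' hk).elim
    | main o s' ha h ho hs =>
      rw [hs] at hk
      cases h with
      | filt2_decide C v => exact ⟨k, .mk .dec p 0 (some v) C, rfl, fun q => sends_of_main ha ho⟩
      | _ => simp at hk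
    | expire _ _ hs => exact (hk' (by rwa [hs] at hk)).elim
    | respond q o s' _ h _ hs =>
      obtain ⟨A, c, rfl, -⟩ := h.frame
      exact (hk' (by rwa [hs] at hk)).elim
    | decide m ha _ _ ho _ =>
      exact ⟨k, .mk .dec p 0 m.val m.cert, rfl, fun q => ⟨by rw [ha]; rfl, by rw [ho]⟩⟩

/-- Once a correct process has halted, all of them decide. -/
theorem IsRun.decides_of_halted (hρ : ρ.IsRun t F input) {p q : Fin n} (hp : p ∉ F) (hq : q ∉ F)
    {k : ℕ} (hk : (ρ.state k p).loc = .halted) : ∃ k v, (ρ.state k q).decision = some v := by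
  obtain ⟨i, m, hκ, hm⟩ := hρ.exists_sends_dec hp hk
  obtain ⟨k, -, -, b, hb, -, hbκ, -⟩ := hρ.delivered hp hq (hm q)
  obtain ⟨j, hj⟩ := hρ.decide_fair q hq (k + 1) b hb (hbκ.trans hκ)
  rcases hj with hj | hj
  · refine ⟨j + 1, (hρ.coherent hq (j + 1)).halted ?_⟩
    have h := hρ.step j
    unfold StepOK at h
    rw [hj] at h
    rw [h.2.2.2.2.2, Function.update_self]
  · exact ⟨j, (hρ.coherent hq j).halted hj⟩

/-! ### The privileged neighbours eventually always hear from the coordinator -/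

theorem IsRun.not_givesUp_of_winning (hρ : ρ.IsRun t F input) {x q : Fin n} (hq : q ∉ F)
    {k : ℕ} (hc : IsCoord n (ρ.state k q).round x)
    (hw : ∀ i, ρ.IssuesQuery i q (ρ.state k q).round → ρ.Winning t x q (ρ.state k q).round) :
    ¬ ρ.GivesUp t k q := by
  rintro ⟨-, hl, -, hno, C, hC, hQ⟩
  obtain ⟨i, -, hi, -⟩ := hρ.exists_issuesQuery hq hl
  have hsub : (↑(C.map Msg.src).toFinset : Set (Fin n)) ⊆
      ρ.responders k q (ρ.state k q).round := by
    intro a ha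
    obtain ⟨m, hm, rfl⟩ := List.mem_map.1 (List.mem_toFinset.1 (Finset.mem_coe.1 ha))
    exact ⟨m, hC m hm, (hQ.2.2 m hm).1, (hQ.2.2 m hm).2, rfl⟩
  have hcard := Set.ncard_le_ncard hsub (Set.toFinite _)
  rw [Set.ncard_coe_finset, List.toFinset_card_of_nodup hQ.2.1, List.length_map, hQ.1] at hcard
  obtain ⟨m, hm, h1, h2, h3⟩ := hw i hi k hcard
  exact hno ⟨m, hm, h1, h2, by rwa [h3]⟩

theorem GivesUp.delta_succ (hρ : ρ.IsRun t F input) {k : ℕ} {x q : Fin n}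
    (h : ρ.GivesUp t k q) (hc : IsCoord n (ρ.state k q).round x) :
    (ρ.state (k + 1) q).delta x = (ρ.state k q).delta x + 1 := by
  obtain ⟨ha, hl, he, -⟩ := h
  obtain ⟨o, hs, -⟩ := hρ.mainStep ha
  generalize ρ.state (k + 1) q = s' at hs
  cases hs <;> simp_all [LState.newDelta]

/-- A process whose links to and from `x` are eventually timely gives up waiting for `x` in finitely
many rounds only: each time it does, it increases its time-out value for `x`, and once that value
exceeds the duration of a round trip the response of `x` arrives before the timer expires. -/
theorem IsRun.exists_not_givesUp_of_timely (hρ : ρ.IsRun t F input) {x q : Fin n} (hx : x ∉ F)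
    (hq : q ∉ F) (hh : ∀ k, (ρ.state k x).loc ≠ .halted) {δ τ : ℝ}
    (hxq : ∀ τ' ≥ τ, ρ.TimelyLinkAt F δ x q τ') (hqx : ∀ τ' ≥ τ, ρ.TimelyLinkAt F δ q x τ') :
    ∃ R, ∀ k, R ≤ (ρ.state k q).round → IsCoord n (ρ.state k q).round x → ¬ ρ.GivesUp t k q := by
  by_contra! hinf
  obtain ⟨φ, hφ⟩ := hρ.respond_bound
  have hdelta : ∀ N : ℕ, ∃ k, N ≤ (ρ.state k q).delta x := by
    intro N
    induction N with
    | zero => exact ⟨0, Nat.zero_le _⟩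
    | succ N ih =>
      obtain ⟨k₀, hk₀⟩ := ih
      obtain ⟨k, hk, hc, hg⟩ := hinf ((ρ.state k₀ q).round + 1)
      have hkk : k₀ ≤ k := by
        by_contra! hlt
        have := hρ.monotone_round hq hlt.le
        simp only at this
        omega
      have := hρ.monotone_delta hq hkk x
      simp only at this
      exact ⟨k + 1, by rw [hg.delta_succ hρ hc]; omega⟩
  obtain ⟨N, hN⟩ := exists_nat_gt (δ + φ + δ)
  obtain ⟨k₁, hk₁⟩ := hdelta N
  obtain ⟨k₂, hk₂⟩ := (hρ.time_unbounded.eventually_ge_atTop τ).exists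
  -- From `K` on, the time-out value is large enough and the links are timely.
  obtain ⟨K, hK₁, hK₂⟩ : ∃ K, k₁ ≤ K ∧ k₂ ≤ K := ⟨_, le_max_left _ _, le_max_right _ _⟩
  obtain ⟨k, hk, hc, ha, hl, he, hno, -⟩ := hinf ((ρ.state K q).round + 1)
  obtain ⟨i, hi, ⟨hact, m, hκ, hr, hout⟩, hdl, hexp⟩ := hρ.exists_issuesQuery hq hl
  obtain ⟨j, hj, hjd⟩ := hexp he
  have hm : ρ.Sends i q x m := ⟨by rw [hact]; rfl, hout x⟩
  have hlate : ∀ {i' q' m'}, ρ.Sends i' q q' m' → m'.kind = .query → m'.round = m.round →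
      K ≤ i' ∧ τ ≤ ρ.time i' := by
    intro i' q' m' h1 h2 h3
    have hKi := hρ.le_of_round_lt hq h1 h2 (K := K) (by omega)
    exact ⟨hKi, hk₂.trans (hρ.time_mono (hK₂.trans hKi))⟩
  obtain ⟨a, b, o, hrec, hab, ho, hoκ, hor, i', hi', q', m', hm', hκ', hr'⟩ :=
    hρ.exists_response hφ hq hx hh hm hκ
  obtain ⟨c, -, hcrec, w, hw, hw1, hw2, hw3⟩ := hρ.delivered hx hq ho
  have h1 := ((hqx _ (hlate hm hκ rfl).2).resolve_right hx) i a m rfl hm hrec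
  have h2 := ((hxq _ ((hlate hm' hκ' hr').2.trans (hρ.time_mono hi'.le))).resolve_right hq)
    b c o rfl ho hcrec
  have h3 : N ≤ (ρ.state i q).delta x :=
    hk₁.trans (hρ.monotone_delta hq (hK₁.trans (hlate hm hκ rfl).1) x)
  have h4 : (N : ℝ) ≤ ((ρ.state i q).delta x : ℝ) := by exact_mod_cast h3
  rw [hdl x hc] at hjd
  -- The response arrives at `c`, the timer expires at `j`, not before its deadline.
  have hcj : c < j := by
    by_contra! hle
    have := hρ.time_mono hle
    linarith
  refine hno ⟨w, hρ.monotone_rcvd hq (show c + 1 ≤ k by omega) hw, hw2.trans hoκ,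
    hw3.trans (hor.trans hr), by rwa [hw1]⟩

/-- If `x` is a `◇x`-BW and does not halt, then `x` and its correct privileged neighbours eventually
never give up waiting for `x`. -/
theorem IsRun.exists_round_not_givesUp (hρ : ρ.IsRun t F input) {x : Fin n} (hx : x ∉ F)
    (hh : ∀ k, (ρ.state k x).loc ≠ .halted) {Y Z : Finset (Fin n)} {δ τ : ℝ}
    (hYZ : ∀ τ' ≥ τ,
      (∀ q ∈ Y, q ∉ F → ρ.TimelyLinkAt F δ x q τ' ∧ ρ.TimelyLinkAt F δ q x τ') ∧
      (∀ q ∈ Z, q ∉ F → ρ.WinningLinkAt t x q τ'))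
    {q : Fin n} (hq : q ∉ F) (hmem : q = x ∨ q ∈ Y ∨ q ∈ Z) :
    ∃ R, ∀ k, R ≤ (ρ.state k q).round → IsCoord n (ρ.state k q).round x → ¬ ρ.GivesUp t k q := by
  rcases hmem with rfl | hY | hZ
  · exact ⟨0, fun k _ hc => hρ.not_givesUp_of_winning hq hc fun i hi =>
      hρ.own_winning q hq i _ hi⟩
  · exact hρ.exists_not_givesUp_of_timely hx hq hh (fun τ' hτ => ((hYZ τ' hτ).1 q hY hq).1)
      fun τ' hτ => ((hYZ τ' hτ).1 q hY hq).2
  · obtain ⟨K, hK⟩ := (hρ.time_unbounded.eventually_ge_atTop τ).exists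
    refine ⟨(ρ.state K q).round + 1, fun k hk hc => hρ.not_givesUp_of_winning hq hc fun i hi => ?_⟩
    obtain ⟨ha, m, hκ, hr, hout⟩ := id hi
    have hm : ρ.Sends i q x m := ⟨by rw [ha]; rfl, hout x⟩
    have hKi := hρ.le_of_round_lt hq hm hκ (K := K) (by omega)
    exact (hYZ _ (hK.trans (hρ.time_mono hKi))).2 q hZ hq i _ rfl hi

/-! ### A round in which more than `t` correct processes hear from the coordinator -/

/-- A correct coordinator gives the same proper value in all its responses of a round. -/
theorem IsRun.exists_coordination_value (hρ : ρ.IsRun t F input) {x : Fin n} (hx : x ∉ F) {r : ℕ}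
    (hc : IsCoord n r x) :
    ∃ v : V, ∀ i q m, ρ.Sends i x q m → m.kind = .response → m.round = r → m.val = some v := by
  by_cases h : ∃ i q m, ρ.Sends i x q m ∧ m.kind = .response ∧ m.round = r
  · obtain ⟨i, q, m, hm, hκ, rfl⟩ := h
    obtain ⟨q₀, hq₀, -⟩ := hρ.sends_response hx hm hκ hc
    obtain ⟨h1, h2, -⟩ := (hρ.coherent hx (i + 1)).cest _ _ hq₀
    obtain ⟨v, hv⟩ := ((hρ.coherent hx (i + 1)).valid q₀ h1).exists_val_of_query h2
    refine ⟨v, fun i' q' m' hm' hκ' hr' => ?_⟩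
    obtain ⟨q₁, hq₁, hval⟩ := hρ.sends_response hx hm' hκ' (by rwa [hr'])
    rw [hr'] at hq₁
    have : q₁ = q₀ := by
      rcases le_total (i + 1) (i' + 1) with hle | hle
      · exact Option.some_injective _ (hq₁.symm.trans (hρ.cest_mono hx hle hq₀))
      · exact Option.some_injective _ ((hρ.cest_mono hx hle hq₁).symm.trans hq₀)
    rw [hval, this, hv]
  · exact ⟨input x, fun i q m h1 h2 h3 => (h ⟨i, q, m, h1, h2, h3⟩).elim⟩

/-- If more than `t` correct processes relay the value of the correct coordinator, then every valid
and authentic `filt2` message of the round carries that value, also if its signer is faulty: the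
quorum that certifies a `filt1` message contains one of those relays, and no relay carries any
other proper value. -/
theorem IsRun.exists_filt2_value (hρ : ρ.IsRun t F input) (ht : t < n) {x : Fin n} (hx : x ∉ F)
    {r : ℕ} (hc : IsCoord n r x) {A : Finset (Fin n)} (hA : t < A.card) (hAF : ∀ q ∈ A, q ∉ F)
    (hgive : ∀ q ∈ A, ∀ k, (ρ.state k q).round = r → ¬ ρ.GivesUp t k q) :
    ∃ v : V, ∀ k m, Valid t m → ρ.Authentic F k m → m.kind = .filt2 → m.round = r →
      m.val = some v := by
  obtain ⟨v, hv⟩ := hρ.exists_coordination_value hx hc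
  have hres : ∀ k b, ρ.Authentic F k b → b.kind = .response → b.round = r →
      IsCoord n r b.src → b.val = some v := by
    intro k b hb hκ hr hcb
    obtain rfl := hc.eq hcb
    obtain ⟨i, -, q, hs⟩ := hb.exists_sends hx
    exact hv i q b hs hκ hr
  have hrelay : ∀ k m, Valid t m → ρ.Authentic F k m → m.kind = .relay → m.round = r →
      (m.val = none ∨ m.val = some v) ∧ (m.src ∈ A → m.val = some v) := by
    rintro k m hm hau hκ rfl
    constructor
    · refine (hm.relay_cases hκ).imp_right ?_
      rintro ⟨b, hb, h1, h2, h3, h4⟩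
      rw [h4]
      exact hres k b (hau.of_mem_cert hb) h1 h2 h3
    · intro hsA
      obtain ⟨i, -, q, hs⟩ := hau.exists_sends (hAF _ hsA)
      obtain ⟨h0, h⟩ := hρ.sends_relay (hAF _ hsA) hs hκ
      obtain ⟨b, hb, h1, h2, h3, h4⟩ := h.resolve_left (hgive _ hsA i h0.symm)
      rw [h4]
      exact hres i b (hρ.authentic (hAF _ hsA) hb) h1 h2 h3
  have hfilt1 : ∀ k m, Valid t m → ρ.Authentic F k m → m.kind = .filt1 → m.round = r →
      m.val = some v := by
    rintro k m hm hau hκ rfl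
    obtain ⟨hQ, hvC, hout⟩ := hm.filt1_cert hκ
    have hC : ∀ b ∈ m.cert, (b.val = none ∨ b.val = some v) ∧ (b.src ∈ A → b.val = some v) :=
      fun b hb => hrelay k b (hvC b hb) (hau.of_mem_cert hb) (hQ.2.2 b hb).1 (hQ.2.2 b hb).2
    refine hout.eq_some ?_
    obtain ⟨a, ha, haA⟩ := hQ.exists_src_mem hA
    ext y
    constructor
    · rintro ⟨⟨b, hb, rfl⟩, hne⟩
      exact (hC b hb).1.resolve_left hne
    · rintro rfl
      exact ⟨⟨a, ha, (hC a ha).2 haA⟩, by simp⟩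
  refine ⟨v, ?_⟩
  rintro k m hm hau hκ rfl
  obtain ⟨hQ, hvC, hout⟩ := hm.filt2_cert hκ
  exact hout.eq_some (vals_eq_singleton (hQ.ne_nil ht) fun b hb =>
    hfilt1 k b (hvC b hb) (hau.of_mem_cert hb) (hQ.2.2 b hb).1 (hQ.2.2 b hb).2)

/-- Some correct process halts. -/
theorem IsRun.exists_halted (hρ : ρ.IsRun t F input) (ht : t < n) (hF : F.card ≤ t) {x : Fin n}
    (hBW : ρ.IsEventuallyBW t F (2 * t) x) : ∃ p ∉ F, ∃ k, (ρ.state k p).loc = .halted := by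
  by_contra! hh
  obtain ⟨hx, Y, Z, hdis, hxY, hxZ, hcard, δ, τ, hYZ⟩ := hBW
  let A := insert x (Y ∪ Z) \ F
  have hAF : ∀ q ∈ A, q ∉ F := fun q hq => (Finset.mem_sdiff.1 hq).2
  have hA : t < A.card := by
    have h1 := Finset.le_card_sdiff F (insert x (Y ∪ Z))
    rw [Finset.card_insert_of_notMem (by simp [hxY, hxZ]), Finset.card_union_of_disjoint hdis] at h1
    change _ ≤ A.card at h1
    omega
  have hev : ∀ q, ∀ᶠ r in Filter.atTop, q ∈ A → ∀ k, (ρ.state k q).round = r → IsCoord n r x →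
      ¬ ρ.GivesUp t k q := by
    intro q
    by_cases hq : q ∈ A
    · obtain ⟨R, hR⟩ := hρ.exists_round_not_givesUp hx (hh x hx) hYZ (hAF q hq)
        (by simpa using (Finset.mem_sdiff.1 hq).1)
      filter_upwards [Filter.eventually_ge_atTop R] with r hr _ k hk hc
      exact hR k (hk ▸ hr) (hk ▸ hc)
    · exact .of_forall fun r hq' => (hq hq').elim
  obtain ⟨R, hR⟩ := Filter.eventually_atTop.1 (Filter.eventually_all.2 hev)
  have hn : 0 < n := by omega
  obtain ⟨r, hRr, hc⟩ : ∃ r, R ≤ r ∧ IsCoord n (r + 1) x := by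
    refine ⟨x.val + n * R, le_add_left (Nat.le_mul_of_pos_left R hn), ?_⟩
    rw [IsCoord, Nat.add_sub_cancel, Nat.add_mul_mod_self_left, Nat.mod_eq_of_lt x.isLt]
  obtain ⟨v, hv⟩ := hρ.exists_filt2_value ht hx hc hA hAF fun q hq k hk =>
    hR (r + 1) (hRr.trans r.le_succ) q hq k hk hc
  obtain ⟨-, k, C, hC, hQ, hno⟩ := hρ.exists_filt2_step hF hh (r := r + 1) (fun q hq =>
    hρ.reaches_waitFilt2 hF hh (fun q hq => hρ.reaches_waitFilt1 hF hh (fun q hq =>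
      hρ.reaches_waitRelay hF hh hq (hρ.reaches_waitResponse hn hq (hh q hq)
        (hρ.reaches_newRound hn hF hh r q hq))) hq) hq) hx
  exact hno ⟨v, vals_eq_singleton (hQ.ne_nil ht) fun m hm =>
    hv k m ((hρ.coherent hx k).valid m (hC m hm)) (hρ.authentic hx (hC m hm))
      (hQ.2.2 m hm).1 (hQ.2.2 m hm).2⟩

end Trace

end ByzBW

theorem theorem2 {V : Type*} (n t : ℕ) (hn : 3 * t < n) (F : Finset (Fin n)) (hF : F.card ≤ t)
    (input : Fin n → V) (ρ : ByzBW.Trace n V) (hρ : ρ.IsRun t F input)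
    (hBW : ∃ x, ρ.IsEventuallyBW t F (2 * t) x) :
    ∀ p, p ∉ F → ∃ k v, (ρ.state k p).decision = some v := by
  obtain ⟨x, hx⟩ := hBW
  obtain ⟨p, hp, k, hk⟩ := hρ.exists_halted (by omega) hF hx
  exact fun q hq => hρ.decides_of_halted hp hq hk
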